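/- Let $d\ge 1$, let $\Omega\subset\mathbb{R}^d$ be a bounded open set with boundary $\Gamma=\partial\Omega$ of class $C^2$, let $T>0$, $c\in W^{1,\infty}(\Omega)$ and $\xi\in L^2((0,T);L^2(\Omega))$, and set $\Phi(y)=\frac12\int_0^T\int_\Omega c\,y^2\,dx\,dt$. Solutions of wave equations are understood in the sense of transposition. **Locally distributed control.** Let $b\in C(\overline\Omega)$, $(y^0,y^1)\in H_0^1(\Omega)\times L^2(\Omega)$ and $v\in L^2((0,T);L^2(\Omega))$. We say that $v$ *insensitizes* $\Phi$ if for all $(z^0,z^1)\in H_0^1(\Omega)\times L^2(\Omega)$ the solution $y=y_{\tau_0,\tau_1}\in C([0,T];H_0^1(\Omega))\cap C^1([0,T];L^2(\Omega))$ of $$y_{tt}-\Delta y=\xi+bv \ \text{ in }(0,T)\times\Omega,\qquad y=0\ \text{ on }(0,T)\times\Gamma,\qquad y(0)=y^0+\tau_0z^0,\quad y_t(0)=y^1+\tau_1z^1$$ satisfies $\frac{\partial}{\partial\tau_0}\Phi(y_{\tau_0,\tau_1})=\frac{\partial}{\partial\tau_1}\Phi(y_{\tau_0,\tau_1})=0$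 at $(\tau_0,\tau_1)=(0,0)$. Let $(y_1,y_2)$ be the solution of the cascade system $$\begin{cases} y_{1,tt}-\Delta y_1+c\,y_2=0 & \text{in }(0,T)\times\Omega,\\ y_{2,tt}-\Delta y_2=\xi+bv & \text{in }(0,T)\times\Omega,\\ y_1=y_2=0 & \text{on }(0,T)\times\Gamma,\\ (y_1,y_2,y_{1,t},y_{2,t})|_{t=0}=(0,y^0,0,y^1) & \text{in }\Omega. \end{cases}$$ Then $y_1(T)=y_{1,t}(T)=0$ if and only if $v$ insensitizes $\Phi$. In particular, if $(y_1,y_2,y_{1,t},y_{2,t})(T)=(0,0,0,0)$, then $v$ both insensitizes $\Phi$ and drives the solution of the scalar equation $y_{tt}-\Delta y=\xi+bv$ in $(0,T)\times\Omega$, $y=0$ on $(0,T)\times\Gamma$, $(y,y_t)(0)=(y^0,y^1)$, to equilibrium, that is, $y(T)=y_t(T)=0$. **Boundary control.** Let $b\in C(\Gamma)$, $(y^0,y^1)\in L^2(\Omega)\times H^{-1}(\Omega)$ and $v\in L^2((0,T);L^2(\Gamma))$. We say that $v$ *insensitizes* $\Phi$ if for all $(z^0,z^1)\in L^2(\Omega)\times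 H^{-1}(\Omega)$ the solution $y=y_{\tau_0,\tau_1}\in C([0,T];L^2(\Omega))\cap C^1([0,T];H^{-1}(\Omega))$ of $$y_{tt}-\Delta y=\xi \ \text{ in }(0,T)\times\Omega,\qquad y=bv\ \text{ on }(0,T)\times\Gamma,\qquad y(0)=y^0+\tau_0z^0,\quad y_t(0)=y^1+\tau_1z^1$$ satisfies $\frac{\partial}{\partial\tau_0}\Phi(y_{\tau_0,\tau_1})=\frac{\partial}{\partial\tau_1}\Phi(y_{\tau_0,\tau_1})=0$ at $(\tau_0,\tau_1)=(0,0)$. Let $(y_1,y_2)$ be the solution of the cascade system $$\begin{cases} y_{1,tt}-\Delta y_1+c\,y_2=0 & \text{in }(0,T)\times\Omega,\\ y_{2,tt}-\Delta y_2=\xi & \text{in }(0,T)\times\Omega,\\ y_1=0,\quad y_2=bv & \text{on }(0,T)\times\Gamma,\\ (y_1,y_2,y_{1,t},y_{2,t})|_{t=0}=(0,y^0,0,y^1) & \text{in }\Omega. \end{cases}$$ Then $y_1(T)=y_{1,t}(T)=0$ if and only if $v$ insensitizes $\Phi$. In particular, if $(y_1,y_2,y_{1,t},y_{2,t})(T)=(0,0,0,0)$,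 then $v$ both insensitizes $\Phi$ and drives the solution of the scalar equation $y_{tt}-\Delta y=\xi$ in $(0,T)\times\Omega$, $y=bv$ on $(0,T)\times\Gamma$, $(y,y_t)(0)=(y^0,y^1)$, to equilibrium, that is, $y(T)=y_t(T)=0$. -/

import Mathlib

open MeasureTheory Set
open scoped ENNReal ContDiff RealInnerProductSpace

noncomputable section

namespace InsensitizingWave

/-- `ℝ^d` with its Euclidean norm. -/
abbrev Eucl (d : ℕ) : Type := EuclideanSpace ℝ (Fin d)

variable {d : ℕ}

/-! ### The domain and the function spaces -/

/-- `Ω` has a boundary of class `C²`: near each boundary point, `Ω` is a sublevel set `{ρ < 0}` of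
a `C²` function `ρ` without critical points. -/
def HasC2Boundary (Ω : Set (Eucl d)) : Prop :=
  ∀ x ∈ frontier Ω, ∃ U : Set (Eucl d), IsOpen U ∧ x ∈ U ∧ ∃ ρ : Eucl d → ℝ,
    ContDiffOn ℝ 2 ρ U ∧ (∀ p ∈ U, gradient ρ p ≠ 0) ∧ Ω ∩ U = {p ∈ U | ρ p < 0}

/-- Lebesgue measure on `Ω`. -/
abbrev volOn (Ω : Set (Eucl d)) : Measure (Eucl d) := volume.restrict Ω

/-- The surface measure on `Γ = ∂Ω`, that is the `(d-1)`-dimensional Euclidean Hausdorff measure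
(normalised so as to agree with Lebesgue measure on `(d-1)`-dimensional subspaces). -/
abbrev surf (Ω : Set (Eucl d)) : Measure (Eucl d) :=
  (Measure.euclideanHausdorffMeasure (d - 1)).restrict (frontier Ω)

/-- `L²(Ω)`. -/
abbrev L2 (Ω : Set (Eucl d)) : Type := Lp ℝ 2 (volOn Ω)

/-- `L²(Ω; ℝ^d)`. -/
abbrev L2Vec (Ω : Set (Eucl d)) : Type := Lp (Eucl d) 2 (volOn Ω)

/-- `L²(Γ)`. -/
abbrev L2Bdry (Ω : Set (Eucl d)) : Type := Lp ℝ 2 (surf Ω)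

/-- `φ ∈ C_c^∞(Ω)`. -/
def IsTestFun (Ω : Set (Eucl d)) (φ : Eucl d → ℝ) : Prop :=
  ContDiff ℝ ∞ φ ∧ HasCompactSupport φ ∧ tsupport φ ⊆ Ω

/-- `c ∈ W^{1,∞}(Ω)`: `c` is essentially bounded and has an essentially bounded weak gradient. -/
def IsW1Infty (Ω : Set (Eucl d)) (c : Eucl d → ℝ) : Prop :=
  MemLp c ∞ (volOn Ω) ∧ ∃ G : Eucl d → Eucl d, MemLp G ∞ (volOn Ω) ∧
    ∀ φ : Eucl d → ℝ, IsTestFun Ω φ →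
      ∫ x in Ω, c x • gradient φ x = - ∫ x in Ω, φ x • G x

/-- `H_0^1(Ω)`: the closure of the pairs `(φ, ∇φ)`, `φ ∈ C_c^∞(Ω)`, in `L²(Ω) × L²(Ω; ℝ^d)`.
An element is a function together with its weak gradient; the norm is the `H^1` norm. -/
def H01 (Ω : Set (Eucl d)) : Submodule ℝ (WithLp 2 (L2 Ω × L2Vec Ω)) :=
  (Submodule.span ℝ {p | ∃ φ : Eucl d → ℝ, IsTestFun Ω φ ∧
    p.fst =ᵐ[volOn Ω] φ ∧ p.snd =ᵐ[volOn Ω] gradient φ}).topologicalClosure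

/-- The inclusion `H_0^1(Ω) → L²(Ω)`. -/
def toL2 (Ω : Set (Eucl d)) : H01 Ω →L[ℝ] L2 Ω :=
  (WithLp.fstL 2 ℝ (L2 Ω) (L2Vec Ω)).comp (H01 Ω).subtypeL

/-- The gradient `H_0^1(Ω) → L²(Ω; ℝ^d)`. -/
def grad (Ω : Set (Eucl d)) : H01 Ω →L[ℝ] L2Vec Ω :=
  (WithLp.sndL 2 ℝ (L2 Ω) (L2Vec Ω)).comp (H01 Ω).subtypeL

/-- `H^{-1}(Ω)`, the dual space of `H_0^1(Ω)`. -/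
abbrev Hneg1 (Ω : Set (Eucl d)) : Type := StrongDual ℝ (H01 Ω)

/-- The inclusion `L²(Ω) → H^{-1}(Ω)` with pivot space `L²(Ω)`: `f ↦ (u ↦ ∫_Ω f u)`. -/
def toHneg1 (Ω : Set (Eucl d)) (f : L2 Ω) : Hneg1 Ω := (innerSL ℝ f).comp (toL2 Ω)

open Classical in
/-- Multiplication of `f ∈ L²(μ)` by a function `a`. It is only used with `a` bounded and
measurable, in which case `a f ∈ L²(μ)` and the default value `0` is not taken. -/
def mulL2 {μ : Measure (Eucl d)} (a : Eucl d → ℝ) (f : Lp ℝ 2 μ) : Lp ℝ 2 μ :=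
  if h : MemLp (fun x => a x * f x) 2 μ then h.toLp _ else 0

/-- `f ∈ L²((0,T); X)`. -/
def IsL2Time {X : Type*} [NormedAddCommGroup X] (T : ℝ) (f : ℝ → X) : Prop :=
  MemLp f 2 (volume.restrict (Ioo 0 T))

/-! ### The Dirichlet Laplacian and the normal derivative -/

/-- `u` is in the domain of the Dirichlet Laplacian (which is `H²(Ω) ∩ H_0^1(Ω)`) and `-Δu = f`. -/
def IsNegLaplacian (Ω : Set (Eucl d)) (u : H01 Ω) (f : L2 Ω) : Prop :=
  ∀ φ : H01 Ω, ⟪grad Ω u, grad Ω φ⟫ = ⟪f, toL2 Ω φ⟫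

/-- `u` is in the domain of the Dirichlet Laplacian and `g = ∂u/∂ν ∈ L²(Γ)`, in the sense of
Green's formula `∫_Γ (∂u/∂ν) φ dσ = ∫_Ω ∇u · ∇φ + ∫_Ω (Δu) φ`. -/
def IsNormalDeriv (Ω : Set (Eucl d)) (u : H01 Ω) (g : L2Bdry Ω) : Prop :=
  ∃ f : L2 Ω, IsNegLaplacian Ω u f ∧
    ∀ φ : Eucl d → ℝ, ContDiff ℝ ∞ φ → HasCompactSupport φ →
      ∫ x, g x * φ x ∂(surf Ω) =
        (∫ x in Ω, ⟪grad Ω u x, gradient φ x⟫) - ∫ x in Ω, f x * φ x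

open Classical in
/-- The normal derivative `∂u/∂ν ∈ L²(Γ)` of `u ∈ H²(Ω) ∩ H_0^1(Ω)`. On a bounded `C²` domain it
exists for all these `u`, so that the default value `0` is taken only outside that space. -/
def normalDeriv (Ω : Set (Eucl d)) (u : H01 Ω) : L2Bdry Ω :=
  if h : ∃ g, IsNormalDeriv Ω u g then h.choose else 0

/-! ### Solutions by transposition of the wave equation -/

/-- `w` is a regular solution, with time derivative `w'`, of the dual problem
`w_tt - Δw = 0` in `(0,t) × Ω`, `w = 0` on `(0,t) × Γ`. Regular means
`w ∈ C([0,t]; H² ∩ H_0^1) ∩ C¹([0,t]; H_0^1) ∩ C²([0,t]; L²)`; the final data `(w(t), w'(t))` are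
arbitrary elements of `(H² ∩ H_0^1) × H_0^1`, a dense subset of `H_0^1 × L²` and of
`L² × H^{-1}`. -/
structure IsDualSolution (Ω : Set (Eucl d)) (t : ℝ) (w w' : ℝ → H01 Ω) : Prop where
  hasDeriv : ∀ s ∈ Icc 0 t, HasDerivWithinAt w (w' s) (Icc 0 t) s
  cont_deriv : ContinuousOn w' (Icc 0 t)
  wave : ∃ f : ℝ → L2 Ω, ContinuousOn f (Icc 0 t) ∧ ∀ s ∈ Icc 0 t,
    IsNegLaplacian Ω (w s) (f s) ∧
      HasDerivWithinAt (fun r => toL2 Ω (w' r)) (- f s) (Icc 0 t) s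

/-- Solution by transposition, of class `C([0,T]; H_0^1) ∩ C¹([0,T]; L²)`, with time derivative
`y'`, of
`y_tt - Δy = F` in `(0,T) × Ω`, `y = 0` on `(0,T) × Γ`, `(y, y_t)(0) = (y⁰, y¹)`,
where `F ∈ L²((0,T); L²(Ω))` and `(y⁰, y¹) ∈ H_0^1(Ω) × L²(Ω)`. -/
structure IsEnergySolution (Ω : Set (Eucl d)) (T : ℝ) (F : ℝ → L2 Ω) (y0 : H01 Ω) (y1 : L2 Ω)
    (y : ℝ → H01 Ω) (y' : ℝ → L2 Ω) : Prop where
  cont : ContinuousOn y (Icc 0 T)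
  cont_deriv : ContinuousOn y' (Icc 0 T)
  hasDeriv : ∀ t ∈ Icc 0 T, HasDerivWithinAt (fun s => toL2 Ω (y s)) (y' t) (Icc 0 T) t
  init : y 0 = y0
  init_deriv : y' 0 = y1
  transposition : ∀ t ∈ Icc 0 T, ∀ w w' : ℝ → H01 Ω, IsDualSolution Ω t w w' →
    ⟪y' t, toL2 Ω (w t)⟫ - ⟪toL2 Ω (y t), toL2 Ω (w' t)⟫ =
      ⟪y1, toL2 Ω (w 0)⟫ - ⟪toL2 Ω y0, toL2 Ω (w' 0)⟫ + ∫ s in 0..t, ⟪F s, toL2 Ω (w s)⟫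

/-- Solution by transposition, of class `C([0,T]; L²) ∩ C¹([0,T]; H^{-1})`, with time derivative
`y'`, of
`y_tt - Δy = F` in `(0,T) × Ω`, `y = g` on `(0,T) × Γ`, `(y, y_t)(0) = (y⁰, y¹)`,
where `F ∈ L²((0,T); L²(Ω))`, `g ∈ L²((0,T); L²(Γ))` and `(y⁰, y¹) ∈ L²(Ω) × H^{-1}(Ω)`. -/
structure IsBoundarySolution (Ω : Set (Eucl d)) (T : ℝ) (F : ℝ → L2 Ω) (g : ℝ → L2Bdry Ω)
    (y0 : L2 Ω) (y1 : Hneg1 Ω) (y : ℝ → L2 Ω) (y' : ℝ → Hneg1 Ω) : Prop where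
  cont : ContinuousOn y (Icc 0 T)
  cont_deriv : ContinuousOn y' (Icc 0 T)
  hasDeriv : ∀ t ∈ Icc 0 T, HasDerivWithinAt (fun s => toHneg1 Ω (y s)) (y' t) (Icc 0 T) t
  init : y 0 = y0
  init_deriv : y' 0 = y1
  transposition : ∀ t ∈ Icc 0 T, ∀ w w' : ℝ → H01 Ω, IsDualSolution Ω t w w' →
    y' t (w t) - ⟪y t, toL2 Ω (w' t)⟫ =
      y1 (w 0) - ⟪y0, toL2 Ω (w' 0)⟫ + (∫ s in 0..t, ⟪F s, toL2 Ω (w s)⟫)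
        - ∫ s in 0..t, ⟪g s, normalDeriv Ω (w s)⟫

/-! ### The cascade systems -/

/-- `(y₁, y₂, y₁', y₂')` solves the cascade system with locally distributed control
`y₁_tt - Δy₁ + c y₂ = 0`, `y₂_tt - Δy₂ = ξ + b v` in `(0,T) × Ω`, `y₁ = y₂ = 0` on `(0,T) × Γ`,
with initial data `(y₁, y₂, y₁', y₂')(0) = (0, y⁰, 0, y¹)`. -/
def IsCascadeInterior (Ω : Set (Eucl d)) (T : ℝ) (c b : Eucl d → ℝ) (ξ v : ℝ → L2 Ω)
    (y0 : H01 Ω) (y1 : L2 Ω) (Y₁ Y₂ : ℝ → H01 Ω) (Y₁' Y₂' : ℝ → L2 Ω) : Prop :=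
  IsEnergySolution Ω T (fun t => - mulL2 c (toL2 Ω (Y₂ t))) 0 0 Y₁ Y₁' ∧
  IsEnergySolution Ω T (fun t => ξ t + mulL2 b (v t)) y0 y1 Y₂ Y₂'

/-- `(y₁, y₂, y₁', y₂')` solves the cascade system with boundary control
`y₁_tt - Δy₁ + c y₂ = 0`, `y₂_tt - Δy₂ = ξ` in `(0,T) × Ω`, `y₁ = 0`, `y₂ = b v` on `(0,T) × Γ`,
with initial data `(y₁, y₂, y₁', y₂')(0) = (0, y⁰, 0, y¹)`. -/
def IsCascadeBoundary (Ω : Set (Eucl d)) (T : ℝ) (c b : Eucl d → ℝ) (ξ : ℝ → L2 Ω)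
    (v : ℝ → L2Bdry Ω) (y0 : L2 Ω) (y1 : Hneg1 Ω)
    (Y₁ : ℝ → H01 Ω) (Y₂ : ℝ → L2 Ω) (Y₁' : ℝ → L2 Ω) (Y₂' : ℝ → Hneg1 Ω) : Prop :=
  IsEnergySolution Ω T (fun t => - mulL2 c (Y₂ t)) 0 0 Y₁ Y₁' ∧
  IsBoundarySolution Ω T ξ (fun t => mulL2 b (v t)) y0 y1 Y₂ Y₂'

/-! ### Insensitizing controls and controls that drive to rest -/

/-- The functional `Φ = ½ ∫_0^T ∫_Ω c y² dx dt`. -/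
def Phi (Ω : Set (Eucl d)) (T : ℝ) (c : Eucl d → ℝ) (y : ℝ → L2 Ω) : ℝ :=
  (1 / 2) * ∫ t in 0..T, ∫ x in Ω, c x * (y t x) ^ 2

/-- `S τ₀ τ₁` being the set of solutions for the amplitudes `τ₀, τ₁` of the perturbation: solutions
exist for all amplitudes, and along them `∂Φ/∂τ₀` and `∂Φ/∂τ₁` exist and vanish at
`(τ₀, τ₁) = (0, 0)`. -/
def IsStationary (Ω : Set (Eucl d)) (T : ℝ) (c : Eucl d → ℝ)
    (S : ℝ → ℝ → Set (ℝ → L2 Ω)) : Prop :=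
  (∀ τ₀ τ₁, (S τ₀ τ₁).Nonempty) ∧
  ∀ y : ℝ → ℝ → ℝ → L2 Ω, (∀ τ₀ τ₁, y τ₀ τ₁ ∈ S τ₀ τ₁) →
    HasDerivAt (fun τ₀ => Phi Ω T c (y τ₀ 0)) 0 0 ∧
    HasDerivAt (fun τ₁ => Phi Ω T c (y 0 τ₁)) 0 0

/-- `v` insensitizes `Φ` along the solutions of `y_tt - Δy = ξ + b v` in `(0,T) × Ω`,
`y = 0` on `(0,T) × Γ`, `y(0) = y⁰ + τ₀ z⁰`, `y_t(0) = y¹ + τ₁ z¹`, for all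
`(z⁰, z¹) ∈ H_0^1(Ω) × L²(Ω)`. -/
def InsensitizesInterior (Ω : Set (Eucl d)) (T : ℝ) (c b : Eucl d → ℝ) (ξ v : ℝ → L2 Ω)
    (y0 : H01 Ω) (y1 : L2 Ω) : Prop :=
  ∀ (z0 : H01 Ω) (z1 : L2 Ω), IsStationary Ω T c fun τ₀ τ₁ =>
    {u | ∃ (y : ℝ → H01 Ω) (y' : ℝ → L2 Ω),
      IsEnergySolution Ω T (fun t => ξ t + mulL2 b (v t)) (y0 + τ₀ • z0) (y1 + τ₁ • z1) y y' ∧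
      u = fun t => toL2 Ω (y t)}

/-- `v` insensitizes `Φ` along the solutions of `y_tt - Δy = ξ` in `(0,T) × Ω`,
`y = b v` on `(0,T) × Γ`, `y(0) = y⁰ + τ₀ z⁰`, `y_t(0) = y¹ + τ₁ z¹`, for all
`(z⁰, z¹) ∈ L²(Ω) × H^{-1}(Ω)`. -/
def InsensitizesBoundary (Ω : Set (Eucl d)) (T : ℝ) (c b : Eucl d → ℝ) (ξ : ℝ → L2 Ω)
    (v : ℝ → L2Bdry Ω) (y0 : L2 Ω) (y1 : Hneg1 Ω) : Prop :=
  ∀ (z0 : L2 Ω) (z1 : Hneg1 Ω), IsStationary Ω T c fun τ₀ τ₁ =>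
    {u | ∃ y' : ℝ → Hneg1 Ω,
      IsBoundarySolution Ω T ξ (fun t => mulL2 b (v t)) (y0 + τ₀ • z0) (y1 + τ₁ • z1) u y'}

/-- `v` is an exact control for `y_tt - Δy = ξ + b v` in `(0,T) × Ω`, `y = 0` on `(0,T) × Γ`,
`(y, y_t)(0) = (y⁰, y¹)`: the solution exists and satisfies `y(T) = y_t(T) = 0`. -/
def DrivesToRestInterior (Ω : Set (Eucl d)) (T : ℝ) (b : Eucl d → ℝ) (ξ v : ℝ → L2 Ω)
    (y0 : H01 Ω) (y1 : L2 Ω) : Prop :=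
  (∃ y y', IsEnergySolution Ω T (fun t => ξ t + mulL2 b (v t)) y0 y1 y y') ∧
  ∀ y y', IsEnergySolution Ω T (fun t => ξ t + mulL2 b (v t)) y0 y1 y y' → y T = 0 ∧ y' T = 0

/-- `v` is an exact control for `y_tt - Δy = ξ` in `(0,T) × Ω`, `y = b v` on `(0,T) × Γ`,
`(y, y_t)(0) = (y⁰, y¹)`: the solution exists and satisfies `y(T) = y_t(T) = 0`. -/
def DrivesToRestBoundary (Ω : Set (Eucl d)) (T : ℝ) (b : Eucl d → ℝ) (ξ : ℝ → L2 Ω)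
    (v : ℝ → L2Bdry Ω) (y0 : L2 Ω) (y1 : Hneg1 Ω) : Prop :=
  (∃ y y', IsBoundarySolution Ω T ξ (fun t => mulL2 b (v t)) y0 y1 y y') ∧
  ∀ y y', IsBoundarySolution Ω T ξ (fun t => mulL2 b (v t)) y0 y1 y y' → y T = 0 ∧ y' T = 0

end InsensitizingWave

end

noncomputable section

namespace InsensitizingWave

open Filter Topology

variable {d : ℕ}

/-! ### The unitary group generated by the inverse of a skew-adjoint operator -/

section UnitaryGroup

set_option linter.unusedSectionVars false

variable {E : Type*} [NormedAddCommGroup E] [InnerProductSpace ℝ E] [CompleteSpace E]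

/-! Both equivalences are one duality computation. Perturbing the initial data changes `y₂` by a
free wave, and `Φ` is quadratic, so its derivative in the direction of a free wave `p` is `∫ ⟪c y₂,
p⟫` (`hasDerivAt_Phi`, `isStationary_iff`). On the other side, `y₁` starts at rest with source `-c
y₂`; the transposition identity at time `T` says that its final state, paired with the final state
of a dual solution `w`, equals `-∫ ⟪c y₂, w⟫`. Since final dual states separate points, `y₁` ends at
rest exactly when `c y₂` is orthogonal to all dual solutions (`rest_iff_pairing_eq_zero`). The
remaining gap is regularity: dual solutions are smoother than the free waves used as perturbations,
and density closes it.

The free waves come from a unitary group on the energy space. The generator `(u, v) ↦ (v, Δu)` is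
unbounded, but its inverse `S` is bounded, injective and skew-adjoint for the Dirichlet inner
product, so the group is built from `S` alone (`exists_unitaryGroup`). Poincaré's inequality makes
the Dirichlet inner product complete.

The same group serves both regularity levels. For a state `x`, the displacement of `G t x` is a wave
in `H_0^1 × L²`, and its velocity is a wave in `L² × H^{-1}`. Applying `S` passes between the
levels: the velocity of `S x` is the displacement of `x`. Every pairing can thus be written as `∫
⟪F, vel (G t x)⟫` (`pairing`), continuous in `x`, and vanishing on the dense range of `S` means
vanishing everywhere.

Uniqueness (`IsEnergySolution.unique`, `IsBoundarySolution.unique`) makes every perturbed solution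
equal to `y₂` plus a free wave. Source and boundary terms are common to all of them and cancel in
differences. -/

theorem inner_apply_of_skew {S : E →L[ℝ] E} (hS : S.adjoint = -S) (x y : E) :
    ⟪S x, y⟫ = -⟪x, S y⟫ := by
  rw [← ContinuousLinearMap.adjoint_inner_right, hS]; simp

/-- The orthogonal complement of the range is the kernel of the adjoint `-S`, which is trivial. -/
theorem denseRange_of_skew {S : E →L[ℝ] E} (hS : S.adjoint = -S) (hinj : Function.Injective S) :
    DenseRange S := by
  have h : S.range.topologicalClosure = ⊤ := by
    rw [Submodule.topologicalClosure_eq_top_iff, ContinuousLinearMap.orthogonal_range, hS,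
      Submodule.eq_bot_iff]
    intro x hx
    have : S x = 0 := by simpa using hx
    exact hinj (by simpa using this)
  have := Submodule.dense_iff_topologicalClosure_eq_top.2 h
  exact this

/-- `ε² - S²`. -/
def yosidaDenom (S : E →L[ℝ] E) (ε : ℝ) : E →L[ℝ] E := ε ^ 2 • (1 : E →L[ℝ] E) - S * S

theorem yosidaDenom_apply (S : E →L[ℝ] E) (ε : ℝ) (x : E) :
    yosidaDenom S ε x = ε ^ 2 • x - S (S x) := by
  simp [yosidaDenom]

theorem inner_yosidaDenom_self {S : E →L[ℝ] E} (hS : S.adjoint = -S) (ε : ℝ) (x : E) :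
    ⟪yosidaDenom S ε x, x⟫ = ε ^ 2 * ‖x‖ ^ 2 + ‖S x‖ ^ 2 := by
  rw [yosidaDenom_apply, inner_sub_left, inner_apply_of_skew hS (S x) x, real_inner_smul_left,
    real_inner_self_eq_norm_sq, real_inner_self_eq_norm_sq]
  ring

/-- Skewness makes `-S²` nonnegative, so `ε² - S²` is coercive with constant `ε²`. -/
theorem isUnit_yosidaDenom {S : E →L[ℝ] E} (hS : S.adjoint = -S) {ε : ℝ} (hε : 0 < ε) :
    IsUnit (yosidaDenom S ε) := by
  refine ContinuousLinearMap.isUnit_of_forall_le_norm_inner_map _ (c := ⟨ε ^ 2, by positivity⟩)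
    (show (0 : ℝ) < ε ^ 2 by positivity) fun x => ?_
  rw [inner_yosidaDenom_self hS]
  change ‖x‖ ^ 2 * ε ^ 2 ≤ _
  rw [Real.norm_of_nonneg (by positivity)]
  nlinarith [sq_nonneg ‖S x‖]

/-- The inverse of `ε² - S²`. -/
def yosidaInv (S : E →L[ℝ] E) (ε : ℝ) : E →L[ℝ] E := Ring.inverse (yosidaDenom S ε)

/-- The bounded approximation `S (S² - ε²)⁻¹` of `S⁻¹`. -/
def yosida (S : E →L[ℝ] E) (ε : ℝ) : E →L[ℝ] E := -(S * yosidaInv S ε)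

theorem commute_yosidaDenom (S : E →L[ℝ] E) (ε : ℝ) : Commute S (yosidaDenom S ε) := by
  unfold yosidaDenom
  exact ((Commute.one_right S).smul_right _).sub_right ((Commute.refl S).mul_right (Commute.refl S))

theorem commute_yosidaInv_of {S R : E →L[ℝ] E} {ε : ℝ} (h : Commute R (yosidaDenom S ε)) :
    Commute R (yosidaInv S ε) := by
  unfold yosidaInv
  by_cases hu : IsUnit (yosidaDenom S ε)
  · obtain ⟨u, hu⟩ := hu
    rw [← hu] at h ⊢
    rw [Ring.inverse_unit]
    exact h.units_inv_right
  · rw [Ring.inverse_non_unit _ hu]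
    exact Commute.zero_right R

theorem commute_yosidaInv (S : E →L[ℝ] E) (ε : ℝ) : Commute S (yosidaInv S ε) :=
  commute_yosidaInv_of (commute_yosidaDenom S ε)

theorem commute_yosida (S : E →L[ℝ] E) (ε : ℝ) : Commute S (yosida S ε) :=
  ((Commute.refl S).mul_right (commute_yosidaInv S ε)).neg_right

theorem yosida_commute_of {S R : E →L[ℝ] E} (h : Commute R S) (ε : ℝ) :
    Commute R (yosida S ε) := by
  refine (h.mul_right (commute_yosidaInv_of ?_)).neg_right
  unfold yosidaDenom
  exact ((Commute.one_right R).smul_right _).sub_right (h.mul_right h)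

theorem yosida_commute (S : E →L[ℝ] E) (ε δ : ℝ) : Commute (yosida S ε) (yosida S δ) :=
  yosida_commute_of (commute_yosida S ε).symm δ

theorem yosidaDenom_mul_inv {S : E →L[ℝ] E} (hS : S.adjoint = -S) {ε : ℝ} (hε : 0 < ε) :
    yosidaDenom S ε * yosidaInv S ε = 1 :=
  Ring.mul_inverse_cancel _ (isUnit_yosidaDenom hS hε)

theorem yosidaDenom_inv_apply {S : E →L[ℝ] E} (hS : S.adjoint = -S) {ε : ℝ} (hε : 0 < ε) (x : E) :
    yosidaDenom S ε (yosidaInv S ε x) = x := by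
  have := congrArg (fun R : E →L[ℝ] E => R x) (yosidaDenom_mul_inv hS hε)
  simpa using this

/-- Write `-S² = (ε² - S²) - ε²`. The last term is the error in approximating `S⁻¹`. -/
theorem yosida_apply_apply {S : E →L[ℝ] E} (hS : S.adjoint = -S) {ε : ℝ} (hε : 0 < ε) (x : E) :
    yosida S ε (S x) = x - ε ^ 2 • yosidaInv S ε x := by
  have h1 : yosida S ε (S x) = -(S (S (yosidaInv S ε x))) := by
    have := congrArg (fun R : E →L[ℝ] E => R x) (commute_yosida S ε).eq
    simp only [mul_apply_eq_comp] at this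
    rw [← this]; simp [yosida]
  have h2 := yosidaDenom_inv_apply hS hε x
  rw [yosidaDenom_apply] at h2
  rw [h1]
  nth_rewrite 2 [← h2]
  abel

/-- For `u = (ε² - S²)⁻¹ x`, coercivity gives `ε² ‖u‖² ≤ ⟪x, u⟫`; apply Cauchy–Schwarz. -/
theorem norm_sq_yosidaInv_le {S : E →L[ℝ] E} (hS : S.adjoint = -S) {ε : ℝ} (hε : 0 < ε) (x : E) :
    ‖ε ^ 2 • yosidaInv S ε x‖ ≤ ‖x‖ := by
  have h := inner_yosidaDenom_self hS ε (yosidaInv S ε x)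
  rw [yosidaDenom_inv_apply hS hε] at h
  have h2 := real_inner_le_norm x (yosidaInv S ε x)
  rw [norm_smul, Real.norm_of_nonneg (by positivity)]
  by_contra! hlt
  have hp : 0 < ‖yosidaInv S ε x‖ := by
    by_contra! h0
    have : ‖yosidaInv S ε x‖ = 0 := le_antisymm h0 (norm_nonneg _)
    rw [this] at hlt
    simp only [mul_zero] at hlt
    exact absurd hlt (not_lt.2 (norm_nonneg _))
  nlinarith [sq_nonneg ‖S (yosidaInv S ε x)‖]

/-- Gains a factor `ε` on the range of `S`: moving `S` across gives `ε² ‖u‖² + ‖S u‖² = -⟪x, S u⟫`,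
and Young's inequality absorbs `‖S u‖²`, leaving `ε ‖u‖ ≤ ‖x‖`. -/
theorem norm_sq_yosidaInv_apply_le {S : E →L[ℝ] E} (hS : S.adjoint = -S) {ε : ℝ} (hε : 0 < ε)
    (x : E) : ‖ε ^ 2 • yosidaInv S ε (S x)‖ ≤ ε * ‖x‖ := by
  set u := yosidaInv S ε (S x) with hu
  have h := inner_yosidaDenom_self hS ε u
  rw [yosidaDenom_inv_apply hS hε, inner_apply_of_skew hS] at h
  have h2 := neg_le_of_abs_le (abs_real_inner_le_norm x (S u))
  have h3 : (ε * ‖u‖) ^ 2 ≤ ‖x‖ ^ 2 := by nlinarith [sq_nonneg (‖x‖ - ‖S u‖), sq_nonneg ‖S u‖]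
  have h4 : ε * ‖u‖ ≤ ‖x‖ := abs_le_of_sq_le_sq' h3 (norm_nonneg _) |>.2
  rw [norm_smul, Real.norm_of_nonneg (by positivity)]
  nlinarith

/-- A sequence of parameters tending to zero. -/
def yosidaEps (n : ℕ) : ℝ := 1 / ((n : ℝ) + 1)

theorem yosidaEps_pos (n : ℕ) : 0 < yosidaEps n := Nat.one_div_pos_of_nat

/-- `yosida` along the sequence `yosidaEps`. -/
def yosidaSeq (S : E →L[ℝ] E) (n : ℕ) : E →L[ℝ] E := yosida S (yosidaEps n)

/-- The error operators are uniformly contractive and tend to zero on the dense range of `S`, hence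
strongly everywhere. -/
theorem tendsto_yosidaSeq {S : E →L[ℝ] E} (hS : S.adjoint = -S) (hinj : Function.Injective S)
    (x : E) : Tendsto (fun n => yosidaSeq S n (S x)) atTop (𝓝 x) := by
  have key : Tendsto (fun n => yosidaEps n ^ 2 • yosidaInv S (yosidaEps n) x) atTop (𝓝 0) := by
    rw [Metric.tendsto_atTop]
    intro δ hδ
    obtain ⟨y, hy⟩ := (denseRange_of_skew hS hinj).exists_dist_lt x (half_pos hδ)
    have h0 : Tendsto (fun n => yosidaEps n * ‖y‖) atTop (𝓝 0) := by
      have := (tendsto_one_div_add_atTop_nhds_zero_nat (𝕜 := ℝ)).mul_const ‖y‖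
      simpa [yosidaEps] using this
    obtain ⟨N, hN⟩ := eventually_atTop.1 (h0.eventually (gt_mem_nhds (half_pos hδ)))
    refine ⟨N, fun n hn => ?_⟩
    have e : yosidaEps n ^ 2 • yosidaInv S (yosidaEps n) x =
        yosidaEps n ^ 2 • yosidaInv S (yosidaEps n) (x - S y) +
          yosidaEps n ^ 2 • yosidaInv S (yosidaEps n) (S y) := by
      rw [map_sub, smul_sub]; abel
    rw [dist_zero_right, e]
    have h1 := norm_sq_yosidaInv_le hS (yosidaEps_pos n) (x - S y)
    have h2 := norm_sq_yosidaInv_apply_le hS (yosidaEps_pos n) y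
    have h3 := hN n hn
    rw [dist_eq_norm] at hy
    exact (norm_add_le _ _).trans_lt (by linarith)
  have h := (tendsto_const_nhds (x := x)).sub key
  rw [sub_zero] at h
  exact h.congr fun n => (yosida_apply_apply hS (yosidaEps_pos n) x).symm

/-- The resolvent factor is self-adjoint and commutes with `S`, so the product inherits skewness. -/
theorem adjoint_yosida {S : E →L[ℝ] E} (hS : S.adjoint = -S) {ε : ℝ} (hε : 0 < ε) :
    (yosida S ε).adjoint = -yosida S ε := by
  have hQ : star (yosidaDenom S ε) = yosidaDenom S ε := by
    have hs : star S = -S := hS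
    simp [yosidaDenom, hs]
  have hI : star (yosidaInv S ε) = yosidaInv S ε := by
    have hu := isUnit_yosidaDenom hS hε
    have h1 : star (yosidaInv S ε) * yosidaDenom S ε = 1 := by
      have h := congrArg star (yosidaDenom_mul_inv hS hε)
      rwa [star_mul, hQ, star_one] at h
    have h2 := yosidaDenom_mul_inv hS hε
    calc star (yosidaInv S ε) = star (yosidaInv S ε) * (yosidaDenom S ε * yosidaInv S ε) := by
          rw [h2, mul_one]
      _ = yosidaInv S ε := by rw [← mul_assoc, h1, one_mul]
  rw [← ContinuousLinearMap.star_eq_adjoint]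
  have hs : star S = -S := hS
  rw [yosida, star_neg, star_mul, hI, hs, (commute_yosidaInv S ε).eq]
  simp

theorem norm_exp_apply_of_skew {B : E →L[ℝ] E} (hB : B.adjoint = -B) (t : ℝ) (x : E) :
    ‖NormedSpace.exp (t • B) x‖ = ‖x‖ := by
  let +nondep : NormedAlgebra ℚ (E →L[ℝ] E) := .restrictScalars ℚ ℝ _
  have hmem : t • B ∈ skewAdjoint (E →L[ℝ] E) := by
    rw [skewAdjoint.mem_iff, star_smul, star_trivial, ContinuousLinearMap.star_eq_adjoint, hB,
      smul_neg]
  have hu := NormedSpace.exp_mem_unitary_of_mem_skewAdjoint hmem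
  exact ContinuousLinearMap.norm_map_of_mem_unitary hu x

theorem hasDerivAt_exp_apply (B : E →L[ℝ] E) (t : ℝ) (x : E) :
    HasDerivAt (fun s : ℝ => NormedSpace.exp (s • B) x) (NormedSpace.exp (t • B) (B x)) t := by
  have h := (hasDerivAt_exp_smul_const (𝕂 := ℝ) B t).clm_apply (hasDerivAt_const t x)
  simpa using h

/-- Mean value inequality: the derivative `exp (s B) (B x)` has constant norm `‖B x‖`. -/
theorem norm_exp_sub_le_of_skew {B : E →L[ℝ] E} (hB : B.adjoint = -B) (t : ℝ) (x : E) :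
    ‖NormedSpace.exp (t • B) x - x‖ ≤ |t| * ‖B x‖ := by
  have h := convex_univ.norm_image_sub_le_of_norm_hasDerivWithin_le (C := ‖B x‖)
    (f := fun s : ℝ => NormedSpace.exp (s • B) x)
    (fun s _ => (hasDerivAt_exp_apply B s x).hasDerivWithinAt)
    (fun s _ => (norm_exp_apply_of_skew hB s (B x)).le) (mem_univ 0) (mem_univ t)
  simpa [mul_comm] using h

/-- As `A` and `B` commute, the isometry `exp (t B)` factors out, and only the distance from `exp (t
(A - B))` to the identity remains. -/
theorem norm_exp_sub_exp_le {A B : E →L[ℝ] E} (hA : A.adjoint = -A) (hB : B.adjoint = -B)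
    (hAB : Commute A B) (t : ℝ) (x : E) :
    ‖NormedSpace.exp (t • A) x - NormedSpace.exp (t • B) x‖ ≤ |t| * ‖A x - B x‖ := by
  let +nondep : NormedAlgebra ℚ (E →L[ℝ] E) := .restrictScalars ℚ ℝ _
  have hD : (A - B).adjoint = -(A - B) := by rw [map_sub, hA, hB]; abel
  have hc : Commute (t • B) (t • (A - B)) :=
    ((hAB.symm.sub_right (Commute.refl B)).smul_left t).smul_right t
  have h : NormedSpace.exp (t • A) x =
      NormedSpace.exp (t • B) (NormedSpace.exp (t • (A - B)) x) := by
    have : t • A = t • B + t • (A - B) := by rw [← smul_add]; congr 1; abel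
    rw [this, NormedSpace.exp_add_of_commute hc]; rfl
  rw [h, ← map_sub, norm_exp_apply_of_skew hB]
  simpa using norm_exp_sub_le_of_skew hD t x

/-- The approximating groups. -/
def approxGroup (S : E →L[ℝ] E) (n : ℕ) (t : ℝ) : E →L[ℝ] E :=
  NormedSpace.exp (t • yosidaSeq S n)

variable {S : E →L[ℝ] E}

theorem adjoint_yosidaSeq (hS : S.adjoint = -S) (n : ℕ) :
    (yosidaSeq S n).adjoint = -yosidaSeq S n := adjoint_yosida hS (yosidaEps_pos n)

theorem norm_approxGroup (hS : S.adjoint = -S) (n : ℕ) (t : ℝ) (x : E) :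
    ‖approxGroup S n t x‖ = ‖x‖ := norm_exp_apply_of_skew (adjoint_yosidaSeq hS n) t x

/-- On the range of `S` the previous estimate is uniform for bounded times; isometry extends this to
all `x` by density. -/
theorem uniformCauchySeqOn_approxGroup (hS : S.adjoint = -S) (hinj : Function.Injective S)
    (r : ℝ) (x : E) :
    UniformCauchySeqOn (fun n t => approxGroup S n t x) atTop (Ioo (-r) r) := by
  rw [Metric.uniformCauchySeqOn_iff]
  intro δ hδ
  obtain ⟨y, hy⟩ := (denseRange_of_skew hS hinj).exists_dist_lt x (by positivity : 0 < δ / 4)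
  rw [dist_eq_norm] at hy
  have hc := (tendsto_yosidaSeq hS hinj y).cauchySeq
  obtain ⟨N, hN⟩ := Metric.cauchySeq_iff.1 hc (δ / (2 * (|r| + 1))) (by positivity)
  refine ⟨N, fun m hm n hn t ht => ?_⟩
  have h1 : ‖approxGroup S m t (S y) - approxGroup S n t (S y)‖ ≤ δ / 2 := by
    refine (norm_exp_sub_exp_le (adjoint_yosidaSeq hS m) (adjoint_yosidaSeq hS n)
      (yosida_commute S _ _) t (S y)).trans ?_
    have h2 := hN m hm n hn
    rw [dist_eq_norm] at h2
    have h3 : |t| ≤ |r| + 1 := by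
      have := abs_lt.2 ⟨ht.1, ht.2⟩
      linarith [le_abs_self r]
    calc |t| * _ ≤ (|r| + 1) * (δ / (2 * (|r| + 1))) := by gcongr
      _ = δ / 2 := by field_simp
  have e : approxGroup S m t x - approxGroup S n t x = approxGroup S m t (x - S y) +
      (approxGroup S m t (S y) - approxGroup S n t (S y)) - approxGroup S n t (x - S y) := by
    rw [map_sub, map_sub]; abel
  rw [dist_eq_norm, e]
  refine (norm_sub_le _ _).trans_lt ?_
  have h5 := norm_add_le (approxGroup S m t (x - S y))
    (approxGroup S m t (S y) - approxGroup S n t (S y))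
  rw [norm_approxGroup hS] at h5 ⊢
  linarith

theorem exists_tendsto_approxGroup (hS : S.adjoint = -S) (hinj : Function.Injective S)
    (t : ℝ) (x : E) : ∃ y, Tendsto (fun n => approxGroup S n t x) atTop (𝓝 y) := by
  refine cauchySeq_tendsto_of_complete ?_
  have := uniformCauchySeqOn_approxGroup hS hinj (|t| + 1) x
  exact this.cauchySeq (x := t) ⟨by linarith [neg_abs_le t], by linarith [le_abs_self t]⟩

/-- If `S` is injective and skew-adjoint then `S⁻¹` generates a strongly continuous group of
isometries. -/
theorem exists_unitaryGroup (hS : S.adjoint = -S) (hinj : Function.Injective S) :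
    ∃ G : ℝ → E →L[ℝ] E, (∀ t x, ‖G t x‖ = ‖x‖) ∧ G 0 = 1 ∧ (∀ t x, G t (G (-t) x) = x) ∧
      (∀ t x, G t (S x) = S (G t x)) ∧ (∀ x, Continuous fun t => G t x) ∧
      ∀ t x, HasDerivAt (fun s => G s (S x)) (G t x) t := by
  let +nondep : NormedAlgebra ℚ (E →L[ℝ] E) := .restrictScalars ℚ ℝ _
  choose g hg using exists_tendsto_approxGroup hS hinj
  have hnorm : ∀ t x, ‖g t x‖ = ‖x‖ := fun t x =>
    tendsto_nhds_unique (hg t x).norm (by simp [norm_approxGroup hS])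
  let L : ℝ → E →ₗ[ℝ] E := fun t =>
    { toFun := g t
      map_add' := fun x y => tendsto_nhds_unique (hg t (x + y))
        (by simpa using (hg t x).add (hg t y))
      map_smul' := fun a x => tendsto_nhds_unique (hg t (a • x))
        (by simpa using (hg t x).const_smul a) }
  let G : ℝ → E →L[ℝ] E := fun t => (L t).mkContinuous 1 fun x => by
    rw [one_mul]; exact (hnorm t x).le
  have hu : ∀ r x, TendstoUniformlyOn (fun n t => approxGroup S n t x) (fun t => G t x) atTop
      (Ioo (-r) r) := fun r x =>
    (uniformCauchySeqOn_approxGroup hS hinj r x).tendstoUniformlyOn_of_tendsto fun t _ => hg t x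
  have hmem : ∀ t : ℝ, t ∈ Ioo (-(|t| + 1)) (|t| + 1) := fun t =>
    ⟨by linarith [neg_abs_le t], by linarith [le_abs_self t]⟩
  have hder : ∀ n t x, HasDerivAt (fun s => approxGroup S n s x)
      (approxGroup S n t (yosidaSeq S n x)) t := fun n t x => hasDerivAt_exp_apply _ t x
  refine ⟨G, hnorm, ?_, ?_, ?_, ?_, ?_⟩
  · ext x
    exact tendsto_nhds_unique (hg 0 x) (by simp [approxGroup])
  · intro t x
    -- A composition of strong limits: since the approximants are isometries, the error in the inner
    -- factor is not amplified.
    have h1 : Tendsto (fun n => approxGroup S n t (approxGroup S n (-t) x)) atTop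
        (𝓝 (G t (G (-t) x))) := by
      have h2 := (hg t (g (-t) x))
      have h3 : Tendsto (fun n => approxGroup S n t (approxGroup S n (-t) x - g (-t) x)) atTop
          (𝓝 0) := by
        rw [tendsto_zero_iff_norm_tendsto_zero]
        simp only [norm_approxGroup hS]
        rw [← tendsto_zero_iff_norm_tendsto_zero]
        simpa using (hg (-t) x).sub_const (g (-t) x)
      have h4 := h3.add h2
      rw [zero_add] at h4
      refine h4.congr fun n => ?_
      rw [map_sub]; abel
    refine tendsto_nhds_unique h1 (tendsto_const_nhds.congr fun n => ?_)
    have : approxGroup S n t * approxGroup S n (-t) = 1 := by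
      unfold approxGroup
      rw [← NormedSpace.exp_add_of_commute
        (((Commute.refl (yosidaSeq S n)).smul_left t).smul_right (-t)), ← add_smul]
      simp
    have := congrArg (fun R : E →L[ℝ] E => R x) this
    simpa using this.symm
  · intro t x
    refine tendsto_nhds_unique (hg t (S x)) ?_
    refine ((S.continuous.tendsto _).comp (hg t x)).congr fun n => ?_
    have : Commute S (approxGroup S n t) :=
      Commute.exp_right ((commute_yosida S _).smul_right t)
    have := congrArg (fun R : E →L[ℝ] E => R x) this.eq
    simpa using this
  · intro x
    rw [continuous_iff_continuousAt]
    intro t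
    refine ((hu (|t| + 1) x).continuousOn (Eventually.frequently (Eventually.of_forall fun n s _ => ?_))).continuousAt
      (isOpen_Ioo.mem_nhds (hmem t))
    exact (hder n s x).continuousAt.continuousWithinAt
  · intro t x
    refine hasDerivAt_of_tendstoUniformlyOn (s := Ioo (-(|t| + 1)) (|t| + 1)) isOpen_Ioo
      (f := fun n s => approxGroup S n s (S x))
      (f' := fun n s => approxGroup S n s (yosidaSeq S n (S x))) (g' := fun s => G s x) (l := atTop)
      ?_ (Eventually.of_forall fun n s _ => hder n s (S x)) (fun s _ => hg s (S x)) (hmem t)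
    -- The derivatives are `exp (s Bₙ) (Bₙ (S x))` with `Bₙ (S x) → x`; isometry makes this
    -- replacement uniform in `s`.
    have h1 : TendstoUniformlyOn (fun n s => approxGroup S n s (yosidaSeq S n (S x) - x))
        (fun _ => 0) atTop (Ioo (-(|t| + 1)) (|t| + 1)) := by
      rw [Metric.tendstoUniformlyOn_iff]
      intro δ hδ
      filter_upwards [(Metric.tendsto_nhds.1 (tendsto_yosidaSeq hS hinj x)) δ hδ] with n hn s _
      rw [dist_zero_left, norm_approxGroup hS, ← dist_eq_norm]
      exact hn
    have h2 := h1.add (hu (|t| + 1) x)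
    refine (h2.congr (Eventually.of_forall fun n s _ => ?_)).congr_right fun s _ => ?_
    · simp
    · simp

end UnitaryGroup

/-! ### Test functions and the space `H_0^1(Ω)` -/

section Sobolev

variable {Ω : Set (Eucl d)}

theorem inner_gradient {φ : Eucl d → ℝ} (x v : Eucl d) :
    ⟪gradient φ x, v⟫ = fderiv ℝ φ x v := by
  simp [gradient]

theorem continuous_gradient {φ : Eucl d → ℝ} (h : ContDiff ℝ ∞ φ) : Continuous (gradient φ) :=
  (InnerProductSpace.toDual ℝ (Eucl d)).symm.continuous.comp (h.continuous_fderiv (by simp))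

theorem gradient_eq_zero_of_notMem_tsupport {φ : Eucl d → ℝ} {x : Eucl d} (hx : x ∉ tsupport φ) :
    gradient φ x = 0 := by
  have : fderiv ℝ φ x = 0 := by
    by_contra h
    exact hx (support_fderiv_subset ℝ h)
  simp [gradient, this]

theorem hasCompactSupport_gradient {φ : Eucl d → ℝ} (h : HasCompactSupport φ) :
    HasCompactSupport (gradient φ) :=
  HasCompactSupport.intro h fun _ hx => gradient_eq_zero_of_notMem_tsupport hx

theorem gradient_add {φ ψ : Eucl d → ℝ} (hφ : Differentiable ℝ φ) (hψ : Differentiable ℝ ψ)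
    (x : Eucl d) : gradient (φ + ψ) x = gradient φ x + gradient ψ x := by
  simp [gradient, fderiv_add (hφ x) (hψ x)]

theorem gradient_const_smul {φ : Eucl d → ℝ} (hφ : Differentiable ℝ φ) (a : ℝ) (x : Eucl d) :
    gradient (a • φ) x = a • gradient φ x := by
  simp [gradient, fderiv_const_smul (hφ x)]

theorem IsTestFun.differentiable {φ : Eucl d → ℝ} (h : IsTestFun Ω φ) : Differentiable ℝ φ :=
  h.1.differentiable (by simp)

theorem IsTestFun.add {φ ψ : Eucl d → ℝ} (hφ : IsTestFun Ω φ) (hψ : IsTestFun Ω ψ) :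
    IsTestFun Ω (φ + ψ) :=
  ⟨hφ.1.add hψ.1, hφ.2.1.add hψ.2.1, (tsupport_add φ ψ).trans (union_subset hφ.2.2 hψ.2.2)⟩

theorem IsTestFun.const_smul {φ : Eucl d → ℝ} (hφ : IsTestFun Ω φ) (a : ℝ) :
    IsTestFun Ω (a • φ) :=
  ⟨hφ.1.const_smul a, hφ.2.1.smul_left (f := fun _ => a),
    (tsupport_smul_subset_right (fun _ => a) φ).trans hφ.2.2⟩

theorem isTestFun_zero : IsTestFun Ω (0 : Eucl d → ℝ) :=
  ⟨contDiff_const, HasCompactSupport.zero, by simp⟩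

/-- `u` is represented by the test function `φ`. -/
def IsTestPair (Ω : Set (Eucl d)) (p : WithLp 2 (L2 Ω × L2Vec Ω)) (φ : Eucl d → ℝ) : Prop :=
  IsTestFun Ω φ ∧ p.fst =ᵐ[volOn Ω] φ ∧ p.snd =ᵐ[volOn Ω] gradient φ

/-- Test functions already form a vector space, so the span in `H01` adds nothing. -/
theorem exists_isTestPair_of_mem_span {p : WithLp 2 (L2 Ω × L2Vec Ω)}
    (hp : p ∈ Submodule.span ℝ {p : WithLp 2 (L2 Ω × L2Vec Ω) | ∃ φ : Eucl d → ℝ, IsTestFun Ω φ ∧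
      p.fst =ᵐ[volOn Ω] φ ∧ p.snd =ᵐ[volOn Ω] gradient φ}) :
    ∃ φ, IsTestPair Ω p φ := by
  induction hp using Submodule.span_induction with
  | mem p hp => exact hp
  | zero =>
    refine ⟨0, isTestFun_zero, Lp.coeFn_zero _ _ _, (Lp.coeFn_zero _ _ _).trans ?_⟩
    filter_upwards with x
    simp [gradient]
  | add p q _ _ hp hq =>
    obtain ⟨φ, h1, h2, h3⟩ := hp
    obtain ⟨ψ, k1, k2, k3⟩ := hq
    refine ⟨φ + ψ, h1.add k1, (Lp.coeFn_add _ _).trans (h2.add k2),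
      (Lp.coeFn_add _ _).trans ((h3.add k3).trans ?_)⟩
    filter_upwards with x
    simp [gradient_add h1.differentiable k1.differentiable]
  | smul a p _ hp =>
    obtain ⟨φ, h1, h2, h3⟩ := hp
    refine ⟨a • φ, h1.const_smul a, (Lp.coeFn_smul _ _).trans (h2.const_smul a),
      (Lp.coeFn_smul _ _).trans ((h3.const_smul a).trans ?_)⟩
    filter_upwards with x
    simp [gradient_const_smul h1.differentiable]

theorem H01_induction {P : H01 Ω → Prop} (hcl : IsClosed {u | P u})
    (h : ∀ (u : H01 Ω) (φ : Eucl d → ℝ), IsTestPair Ω u φ → P u) (u : H01 Ω) : P u := by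
  have hu : u ∈ closure {v : H01 Ω | ∃ φ, IsTestPair Ω v φ} := by
    rw [Topology.IsInducing.subtypeVal.closure_eq_preimage_closure_image]
    refine closure_mono ?_ u.2
    intro p hp
    obtain ⟨φ, hφ⟩ := exists_isTestPair_of_mem_span hp
    exact ⟨(⟨p, Submodule.le_topologicalClosure _ hp⟩ : H01 Ω), ⟨φ, hφ⟩, rfl⟩
  refine closure_minimal ?_ hcl hu
  rintro v ⟨φ, hφ⟩
  exact h v φ hφ

theorem memLp_volOn_of_continuous {F : Type*} [NormedAddCommGroup F] {f : Eucl d → F}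
    (hf : Continuous f) (hs : HasCompactSupport f) : MemLp f 2 (volOn Ω) :=
  (hf.memLp_of_hasCompactSupport hs (μ := volume)).restrict Ω

theorem exists_H01_of_isTestFun {φ : Eucl d → ℝ} (hφ : IsTestFun Ω φ) :
    ∃ u : H01 Ω, IsTestPair Ω u φ := by
  let p : WithLp 2 (L2 Ω × L2Vec Ω) := WithLp.toLp 2
    ((memLp_volOn_of_continuous hφ.1.continuous hφ.2.1).toLp φ,
      (memLp_volOn_of_continuous (continuous_gradient hφ.1)
        (hasCompactSupport_gradient hφ.2.1)).toLp (gradient φ))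
  have hp : IsTestPair Ω p φ := ⟨hφ,
    (memLp_volOn_of_continuous hφ.1.continuous hφ.2.1).coeFn_toLp,
    (memLp_volOn_of_continuous (continuous_gradient hφ.1)
      (hasCompactSupport_gradient hφ.2.1)).coeFn_toLp⟩
  exact ⟨⟨p, Submodule.le_topologicalClosure _ (Submodule.subset_span ⟨φ, hp⟩)⟩, hp⟩

theorem IsTestPair.toL2_ae {u : H01 Ω} {φ : Eucl d → ℝ} (h : IsTestPair Ω u φ) :
    toL2 Ω u =ᵐ[volOn Ω] φ := h.2.1

theorem IsTestPair.grad_ae {u : H01 Ω} {φ : Eucl d → ℝ} (h : IsTestPair Ω u φ) :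
    grad Ω u =ᵐ[volOn Ω] gradient φ := h.2.2

theorem IsTestFun.setIntegral_eq {F : Type*} [NormedAddCommGroup F] [NormedSpace ℝ F]
    {φ : Eucl d → ℝ} (h : IsTestFun Ω φ) {f : Eucl d → F} (hf : ∀ x, x ∉ tsupport φ → f x = 0) :
    ∫ x in Ω, f x = ∫ x, f x :=
  setIntegral_eq_integral_of_forall_compl_eq_zero fun x hx => hf x fun h' => hx (h.2.2 h')

/-- A function of `L²(Ω)` orthogonal to all test functions vanishes. -/
theorem ae_eq_zero_of_forall_test (hΩ : IsOpen Ω) {f : Eucl d → ℝ} (hf : MemLp f 2 (volOn Ω))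
    (h : ∀ φ, IsTestFun Ω φ → ∫ x in Ω, φ x * f x = 0) : f =ᵐ[volOn Ω] 0 := by
  have hloc : LocallyIntegrableOn f Ω volume :=
    locallyIntegrableOn_of_locallyIntegrable_restrict (hf.locallyIntegrable (by norm_num))
  have := hΩ.ae_eq_zero_of_integral_contDiff_smul_eq_zero hloc fun φ h1 h2 h3 => by
    have h4 : IsTestFun Ω φ := ⟨h1, h2, h3⟩
    rw [← h φ h4, h4.setIntegral_eq fun x hx => by simp [image_eq_zero_of_notMem_tsupport hx]]
    rfl
  exact (ae_restrict_iff' hΩ.measurableSet).2 this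

/-- The range contains the test functions, and only zero is orthogonal to all of them. -/
theorem denseRange_toL2 (hΩ : IsOpen Ω) : DenseRange (toL2 Ω) := by
  have h : (toL2 Ω).range.topologicalClosure = ⊤ := by
    rw [Submodule.topologicalClosure_eq_top_iff, Submodule.eq_bot_iff]
    intro f hf
    rw [Lp.eq_zero_iff_ae_eq_zero]
    refine ae_eq_zero_of_forall_test hΩ (Lp.memLp f) fun φ hφ => ?_
    obtain ⟨u, hu⟩ := exists_H01_of_isTestFun hφ
    have h1 : ⟪toL2 Ω u, f⟫ = 0 := hf _ ⟨u, rfl⟩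
    rw [L2.inner_def] at h1
    rw [← h1]
    refine integral_congr_ae ?_
    filter_upwards [hu.toL2_ae] with x hx
    simp [hx, mul_comm]
  exact Submodule.dense_iff_topologicalClosure_eq_top.2 h

theorem integral_mul_fderiv_test {φ ψ : Eucl d → ℝ} (hφ : ContDiff ℝ ∞ φ) (hψ : ContDiff ℝ ∞ ψ)
    (hs : HasCompactSupport φ) (v : Eucl d) :
    ∫ x, φ x * fderiv ℝ ψ x v = -∫ x, fderiv ℝ φ x v * ψ x := by
  have c1 : Continuous fun x => fderiv ℝ φ x v :=
    (hφ.continuous_fderiv (by simp)).clm_apply continuous_const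
  have c2 : Continuous fun x => fderiv ℝ ψ x v :=
    (hψ.continuous_fderiv (by simp)).clm_apply continuous_const
  have s1 : HasCompactSupport fun x => fderiv ℝ φ x v := hs.fderiv_apply ℝ v
  exact integral_mul_fderiv_eq_neg_fderiv_mul_of_integrable
    ((c1.mul hψ.continuous).integrable_of_hasCompactSupport (s1.mul_right))
    ((hφ.continuous.mul c2).integrable_of_hasCompactSupport (hs.mul_right))
    ((hφ.continuous.mul hψ.continuous).integrable_of_hasCompactSupport (hs.mul_right))
    (fun x _ => hφ.differentiable (by simp) x) (fun x _ => hψ.differentiable (by simp) x)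

/-- The second component of an element of `H_0^1` is the weak gradient of the first. -/
theorem inner_toL2_fderiv {ψ : Eucl d → ℝ} (hψ : IsTestFun Ω ψ) (v : Eucl d)
    (h1 : MemLp (fun x => fderiv ℝ ψ x v) 2 (volOn Ω)) (h2 : MemLp (fun x => ψ x • v) 2 (volOn Ω))
    (u : H01 Ω) : ⟪toL2 Ω u, h1.toLp _⟫ = -⟪grad Ω u, h2.toLp _⟫ := by
  refine H01_induction (P := fun u => ⟪toL2 Ω u, h1.toLp _⟫ = -⟪grad Ω u, h2.toLp _⟫)
    (isClosed_eq (by fun_prop) (by fun_prop)) (fun u φ hu => ?_) u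
  rw [L2.inner_def, L2.inner_def]
  have e1 : ∫ x in Ω, ⟪toL2 Ω u x, h1.toLp _ x⟫ = ∫ x, φ x * fderiv ℝ ψ x v := by
    rw [← hu.1.setIntegral_eq fun x hx => by simp [image_eq_zero_of_notMem_tsupport hx]]
    refine integral_congr_ae ?_
    filter_upwards [hu.toL2_ae, h1.coeFn_toLp] with x hx hx'
    rw [hx, hx']
    simp [mul_comm]
  have e2 : ∫ x in Ω, ⟪grad Ω u x, h2.toLp _ x⟫ = ∫ x, fderiv ℝ φ x v * ψ x := by
    rw [← hψ.setIntegral_eq fun x hx => by simp [image_eq_zero_of_notMem_tsupport hx]]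
    refine integral_congr_ae ?_
    filter_upwards [hu.grad_ae, h2.coeFn_toLp] with x hx hx'
    rw [hx, hx', real_inner_smul_right, inner_gradient, mul_comm]
  rw [e1, e2, integral_mul_fderiv_test hu.1.1 hψ.1 hu.1.2.1]

theorem grad_eq_zero_of_toL2_eq_zero (hΩ : IsOpen Ω) {u : H01 Ω} (hu : toL2 Ω u = 0) :
    grad Ω u = 0 := by
  rw [Lp.eq_zero_iff_ae_eq_zero]
  have h : ∀ i : Fin d, (fun x => grad Ω u x i) =ᵐ[volOn Ω] 0 := by
    intro i
    have hm : MemLp (fun x => grad Ω u x i) 2 (volOn Ω) :=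
      (EuclideanSpace.proj i : Eucl d →L[ℝ] ℝ).comp_memLp' (Lp.memLp (grad Ω u))
    refine ae_eq_zero_of_forall_test hΩ hm fun ψ hψ => ?_
    set v : Eucl d := EuclideanSpace.single i 1
    have h1 : MemLp (fun x => fderiv ℝ ψ x v) 2 (volOn Ω) := memLp_volOn_of_continuous
      ((hψ.1.continuous_fderiv (by simp)).clm_apply continuous_const) (hψ.2.1.fderiv_apply ℝ v)
    have h2 : MemLp (fun x => ψ x • v) 2 (volOn Ω) := memLp_volOn_of_continuous
      (hψ.1.continuous.smul continuous_const) (hψ.2.1.smul_right)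
    have h3 := inner_toL2_fderiv hψ v h1 h2 u
    rw [hu, inner_zero_left, eq_comm, neg_eq_zero, L2.inner_def] at h3
    rw [← h3]
    refine integral_congr_ae ?_
    filter_upwards [h2.coeFn_toLp] with x hx
    rw [hx, real_inner_smul_right, EuclideanSpace.inner_single_right]
    simp
  filter_upwards [ae_all_iff.2 h] with x hx
  ext i
  exact hx i

theorem H01_ext {u v : H01 Ω} (h1 : toL2 Ω u = toL2 Ω v) (h2 : grad Ω u = grad Ω v) : u = v :=
  Subtype.ext ((WithLp.equiv 2 _).injective (Prod.ext h1 h2))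

/-- The gradient component of a pair is determined by the function. This gives injectivity of `S`
and recovers a displacement from its `L²` class. -/
theorem toL2_injective (hΩ : IsOpen Ω) : Function.Injective (toL2 Ω) := by
  rw [injective_iff_map_eq_zero]
  intro u hu
  refine H01_ext (by simp [hu]) ?_
  rw [grad_eq_zero_of_toL2_eq_zero hΩ hu, map_zero]

theorem norm_sq_eq_integral {F : Type*} [NormedAddCommGroup F] [InnerProductSpace ℝ F]
    {μ : Measure (Eucl d)} (f : Lp F 2 μ) : ‖f‖ ^ 2 = ∫ x, ‖f x‖ ^ 2 ∂μ := by
  rw [← real_inner_self_eq_norm_sq, L2.inner_def]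
  simp

/-- Poincaré's inequality. -/
theorem exists_poincare (hd : 1 ≤ d) (hΩb : Bornology.IsBounded Ω) :
    ∃ C : ℝ, 0 ≤ C ∧ ∀ u : H01 Ω, ‖toL2 Ω u‖ ≤ C * ‖grad Ω u‖ := by
  obtain ⟨R, hR0, hR⟩ := hΩb.exists_pos_norm_le
  refine ⟨2 * R, by positivity, fun u => H01_induction
    (P := fun u => ‖toL2 Ω u‖ ≤ 2 * R * ‖grad Ω u‖)
    (isClosed_le (by fun_prop) (by fun_prop)) (fun u φ hu => ?_) u⟩
  let i : Fin d := ⟨0, hd⟩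
  set v : Eucl d := EuclideanSpace.single i 1 with hv
  have hvn : ‖v‖ = 1 := by simp [hv]
  have hφ := hu.1
  have cg := continuous_gradient hφ.1
  have sg := hasCompactSupport_gradient hφ.2.1
  have i1 : Integrable fun x => φ x ^ 2 :=
    (hφ.1.continuous.pow 2).integrable_of_hasCompactSupport
      (HasCompactSupport.intro hφ.2.1 fun x hx => by simp [image_eq_zero_of_notMem_tsupport hx])
  have i2 : Integrable fun x => ‖gradient φ x‖ ^ 2 :=
    (cg.norm.pow 2).integrable_of_hasCompactSupport
      (HasCompactSupport.intro sg fun x hx => by simp [image_eq_zero_of_notMem_tsupport hx])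
  have e1 : ‖toL2 Ω u‖ ^ 2 = ∫ x, φ x ^ 2 := by
    rw [norm_sq_eq_integral, ← hφ.setIntegral_eq fun x hx => by
      simp [image_eq_zero_of_notMem_tsupport hx]]
    refine integral_congr_ae ?_
    filter_upwards [hu.toL2_ae] with x hx
    simp [hx]
  have e2 : ‖grad Ω u‖ ^ 2 = ∫ x, ‖gradient φ x‖ ^ 2 := by
    rw [norm_sq_eq_integral, ← hφ.setIntegral_eq fun x hx => by
      simp [gradient_eq_zero_of_notMem_tsupport hx]]
    refine integral_congr_ae ?_
    filter_upwards [hu.grad_ae] with x hx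
    simp [hx]
  have hx : ∀ x, fderiv ℝ (fun y : Eucl d => y i) x v = 1 := fun x => by
    have : (fun y : Eucl d => y i) = (EuclideanSpace.proj i : Eucl d →L[ℝ] ℝ) := rfl
    rw [this, ContinuousLinearMap.fderiv]
    simp [hv]
  have hsq : ∀ x, fderiv ℝ (fun y => φ y ^ 2) x v = 2 * φ x * ⟪gradient φ x, v⟫ := fun x => by
    rw [fderiv_fun_pow 2 (hφ.differentiable x), inner_gradient]
    simp
  have hc : ContDiff ℝ ∞ fun y : Eucl d => y i :=
    (EuclideanSpace.proj i : Eucl d →L[ℝ] ℝ).contDiff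
  -- Since `∂ᵢ xᵢ = 1`, integration by parts gives `∫ φ² = -∫ 2 φ (∂ᵢ φ) xᵢ`, with `|xᵢ| ≤ R` on the
  -- support.
  have key := integral_mul_fderiv_test (φ := fun y => φ y ^ 2) (ψ := fun y => y i)
    (hφ.1.pow 2) hc
    (HasCompactSupport.intro hφ.2.1 fun x hx => by simp [image_eq_zero_of_notMem_tsupport hx]) v
  simp only [hx, mul_one, hsq] at key
  have hle : ∫ x, φ x ^ 2 ≤ ∫ x, (φ x ^ 2 / 2 + 2 * R ^ 2 * ‖gradient φ x‖ ^ 2) := by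
    nth_rewrite 1 [key]
    rw [← integral_neg]
    refine integral_mono ?_ ((i1.div_const 2).add (i2.const_mul _)) fun x => ?_
    · exact (((continuous_const.mul hφ.1.continuous).mul (cg.inner continuous_const)).mul
        hc.continuous).neg.integrable_of_hasCompactSupport
        (HasCompactSupport.intro hφ.2.1 fun x hx => by simp [image_eq_zero_of_notMem_tsupport hx])
    · change -(2 * φ x * ⟪gradient φ x, v⟫ * x i) ≤ φ x ^ 2 / 2 + 2 * R ^ 2 * ‖gradient φ x‖ ^ 2
      by_cases hxs : x ∈ tsupport φ
      · have h1 : |x i| ≤ R := (PiLp.norm_apply_le x i).trans (hR x (hφ.2.2 hxs))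
        have h2 : |⟪gradient φ x, v⟫| ≤ ‖gradient φ x‖ := by
          simpa [hvn] using abs_real_inner_le_norm (gradient φ x) v
        have h3 : (⟪gradient φ x, v⟫ * x i) ^ 2 ≤ (‖gradient φ x‖ * R) ^ 2 := by
          rw [sq_le_sq, abs_mul, abs_of_nonneg (by positivity : 0 ≤ ‖gradient φ x‖ * R)]
          gcongr
        -- Young's inequality, weighted so that half of `φ²` is absorbed on the left; this yields
        -- the constant `2 R`.
        nlinarith [sq_nonneg (φ x + 2 * (⟪gradient φ x, v⟫ * x i))]
      · simp [image_eq_zero_of_notMem_tsupport hxs]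
        positivity
  rw [integral_add (i1.div_const 2) (i2.const_mul _), integral_div, integral_const_mul] at hle
  rw [← e1, ← e2] at hle
  refine abs_le_of_sq_le_sq' ?_ (by positivity) |>.2
  nlinarith

end Sobolev

/-! ### The wave group -/

theorem hasDerivWithinAt_neg_clm_comp {A B : Type*} [NormedAddCommGroup A] [NormedSpace ℝ A]
    [NormedAddCommGroup B] [NormedSpace ℝ B] (L : A →L[ℝ] StrongDual ℝ B) {f : ℝ → A} {f' : A}
    {t : ℝ} {I : Set ℝ} (hf : HasDerivAt f f' t) :
    HasDerivWithinAt (fun s => -L (f s)) (-L f') I t :=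
  (L.hasFDerivAt.comp_hasDerivAt t hf).neg.hasDerivWithinAt

theorem hasDerivWithinAt_add_strongDual {A : Type*} [NormedAddCommGroup A] [NormedSpace ℝ A]
    {f g : ℝ → StrongDual ℝ A} {f' g' : StrongDual ℝ A} {t : ℝ} {I : Set ℝ}
    (hf : HasDerivWithinAt f f' I t) (hg : HasDerivWithinAt g g' I t) :
    HasDerivWithinAt (fun s => f s + g s) (f' + g') I t :=
  hf.add hg

/-! ### The Dirichlet form as an operator into the dual space -/

section FormOperator

variable {A B K : Type*} [NormedAddCommGroup A] [InnerProductSpace ℝ A]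
  [NormedAddCommGroup B] [InnerProductSpace ℝ B] [NormedAddCommGroup K]
  [InnerProductSpace ℝ K] {V : Submodule ℝ (WithLp 2 (A × B))}

/-- The operator `V → V*` of the bilinear form `(u, φ) ↦ ⟪D u, D φ⟫`; for `D` the gradient on
`H_0^1(Ω)` it is `-Δ`. -/
def formOp (D : V →L[ℝ] K) : V →L[ℝ] StrongDual ℝ V :=
  LinearMap.mkContinuous₂ (LinearMap.mk₂ ℝ (fun u φ => ⟪D u, D φ⟫)
    (fun u v φ => by rw [map_add, inner_add_left])
    (fun a u φ => by rw [map_smul, real_inner_smul_left]; rfl)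
    (fun u φ ψ => by rw [map_add, inner_add_right])
    (fun a u φ => by rw [map_smul, real_inner_smul_right]; rfl)) (‖D‖ * ‖D‖)
    fun u φ => by
      refine (norm_inner_le_norm (D u) (D φ)).trans ?_
      calc ‖D u‖ * ‖D φ‖ ≤ (‖D‖ * ‖u‖) * (‖D‖ * ‖φ‖) := by
            gcongr <;> exact D.le_opNorm _
        _ = ‖D‖ * ‖D‖ * ‖u‖ * ‖φ‖ := by ring

theorem formOp_apply (D : V →L[ℝ] K) (u φ : V) : formOp D u φ = ⟪D u, D φ⟫ := rfl

theorem hasDerivWithinAt_neg_formOp (D : V →L[ℝ] K) {f : ℝ → V} {f' : V} {t : ℝ} {I : Set ℝ}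
    (hf : HasDerivAt f f' t) :
    HasDerivWithinAt (fun s => -formOp D (f s)) (-formOp D f') I t :=
  hasDerivWithinAt_neg_clm_comp (formOp D) hf

theorem continuous_neg_formOp (D : V →L[ℝ] K) {f : ℝ → V} (hf : Continuous f) :
    Continuous fun s => -formOp D (f s) :=
  ((formOp D).continuous.comp hf).neg

theorem hasDerivWithinAt_add_dual_submodule {f g : ℝ → StrongDual ℝ V} {f' g' : StrongDual ℝ V}
    {t : ℝ} {I : Set ℝ} (hf : HasDerivWithinAt f f' I t) (hg : HasDerivWithinAt g g' I t) :
    HasDerivWithinAt (fun s => f s + g s) (f' + g') I t :=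
  hasDerivWithinAt_add_strongDual hf hg

end FormOperator

/-! ### The inverse of the wave generator -/

section WaveOperator

variable {W H : Type*} [NormedAddCommGroup W] [InnerProductSpace ℝ W] [CompleteSpace W]
  [NormedAddCommGroup H] [InnerProductSpace ℝ H] [CompleteSpace H]

/-- The operator `(f, g) ↦ (-j* g, j f)`. -/
def waveOp (j : W →L[ℝ] H) : WithLp 2 (W × H) →L[ℝ] WithLp 2 (W × H) :=
  ((WithLp.prodContinuousLinearEquiv 2 ℝ W H).symm : W × H →L[ℝ] WithLp 2 (W × H)).comp
    ((-(j.adjoint.comp (WithLp.sndL 2 ℝ W H))).prod (j.comp (WithLp.fstL 2 ℝ W H)))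

theorem waveOp_fst (j : W →L[ℝ] H) (x : WithLp 2 (W × H)) :
    (waveOp j x).fst = -j.adjoint x.snd := rfl

theorem waveOp_snd (j : W →L[ℝ] H) (x : WithLp 2 (W × H)) : (waveOp j x).snd = j x.fst := rfl

theorem adjoint_waveOp (j : W →L[ℝ] H) : (waveOp j).adjoint = -waveOp j := by
  symm
  rw [ContinuousLinearMap.eq_adjoint_iff]
  intro x y
  rw [neg_apply, inner_neg_left, WithLp.prod_inner_apply,
    WithLp.prod_inner_apply]
  change -(⟪(waveOp j x).fst, y.fst⟫ + ⟪(waveOp j x).snd, y.snd⟫) =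
    ⟪x.fst, (waveOp j y).fst⟫ + ⟪x.snd, (waveOp j y).snd⟫
  rw [waveOp_fst, waveOp_fst, waveOp_snd, waveOp_snd, inner_neg_left, inner_neg_right,
    ContinuousLinearMap.adjoint_inner_left, ContinuousLinearMap.adjoint_inner_right]
  ring

/-- Injectivity of `j` kills the first component; dense range, that is injectivity of `j*`, kills
the second. -/
theorem waveOp_injective {j : W →L[ℝ] H} (hj : Function.Injective j) (hd : DenseRange j) :
    Function.Injective (waveOp j) := by
  rw [injective_iff_map_eq_zero]
  intro x hx
  have h1 : j.adjoint x.snd = 0 := by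
    have := congrArg WithLp.fst hx
    rw [waveOp_fst] at this
    simpa using this
  have h2 : j x.fst = 0 := congrArg WithLp.snd hx
  have h3 : x.fst = 0 := hj (by rw [h2, map_zero])
  have h4 : x.snd = 0 := hd.eq_zero_of_inner_left (𝕜 := ℝ) fun w => by
    rw [← ContinuousLinearMap.adjoint_inner_left, h1, inner_zero_left]
  exact (WithLp.equiv 2 _).injective (Prod.ext h3 h4)

end WaveOperator

variable {Ω : Set (Eucl d)}

/-- By Poincaré the gradient is bounded below, so its range is closed. Its `L²` inner product is the
Dirichlet one, for which the wave generator is skew. -/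
theorem exists_energyEquiv (hd : 1 ≤ d) (hΩb : Bornology.IsBounded Ω) :
    ∃ (W : Submodule ℝ (L2Vec Ω)) (_ : CompleteSpace W) (e : H01 Ω ≃L[ℝ] W),
      ∀ u, (e u : L2Vec Ω) = grad Ω u := by
  obtain ⟨C, hC0, hC⟩ := exists_poincare hd hΩb
  have : CompleteSpace (H01 Ω) := (Submodule.isClosed_topologicalClosure _).completeSpace_coe
  have hanti : AntilipschitzWith ⟨C + 1, by positivity⟩ (grad Ω) := by
    refine ContinuousLinearMap.antilipschitz_of_bound _ fun u => ?_
    change ‖u‖ ≤ (C + 1) * ‖grad Ω u‖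
    have h1 : ‖u‖ ^ 2 = ‖toL2 Ω u‖ ^ 2 + ‖grad Ω u‖ ^ 2 :=
      WithLp.prod_norm_sq_eq_of_L2 (u : WithLp 2 (L2 Ω × L2Vec Ω))
    refine abs_le_of_sq_le_sq' ?_ (by positivity) |>.2
    have h2 := hC u
    have h3 : ‖toL2 Ω u‖ ^ 2 ≤ (C * ‖grad Ω u‖) ^ 2 := by gcongr
    nlinarith [mul_nonneg hC0 (sq_nonneg ‖grad Ω u‖)]
  have hcl : IsClosed (range (grad Ω)) := hanti.isClosed_range (grad Ω).uniformContinuous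
  exact ⟨(grad Ω).range, hcl.completeSpace_coe, (grad Ω).equivRange hanti.injective hcl,
    fun u => rfl⟩

/-- The wave group on the energy space: `G t` maps initial data in `H_0^1 × L²` to the state at
time `t`, and `S` is the inverse of its generator. The space `H_0^1` is represented by its image
`W` under the gradient. -/
structure WaveGroup (Ω : Set (Eucl d)) where
  W : Submodule ℝ (L2Vec Ω)
  complete : CompleteSpace W
  e : H01 Ω ≃L[ℝ] W
  e_apply : ∀ u, (e u : L2Vec Ω) = grad Ω u
  S : WithLp 2 (W × L2 Ω) →L[ℝ] WithLp 2 (W × L2 Ω)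
  G : ℝ → WithLp 2 (W × L2 Ω) →L[ℝ] WithLp 2 (W × L2 Ω)
  S_skew : ∀ x y, ⟪S x, y⟫ = -⟪x, S y⟫
  S_dense : DenseRange S
  inner_S_fst : ∀ x u, ⟪(S x).fst, e u⟫ = -⟪x.snd, toL2 Ω u⟫
  S_snd : ∀ x, (S x).snd = toL2 Ω (e.symm x.fst)
  norm_G : ∀ t x, ‖G t x‖ = ‖x‖
  G_zero : G 0 = 1
  G_neg : ∀ t x, G t (G (-t) x) = x
  G_S : ∀ t x, G t (S x) = S (G t x)
  continuous_G : ∀ x, Continuous fun t => G t x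
  hasDerivAt_G : ∀ t x, HasDerivAt (fun s => G s (S x)) (G t x) t

theorem nonempty_waveGroup (hd : 1 ≤ d) (hΩ : IsOpen Ω) (hΩb : Bornology.IsBounded Ω) :
    Nonempty (WaveGroup Ω) := by
  obtain ⟨W, hW, e, he⟩ := exists_energyEquiv hd hΩb
  let j : W →L[ℝ] L2 Ω := (toL2 Ω).comp (e.symm : W →L[ℝ] H01 Ω)
  have hj : Function.Injective j := (toL2_injective hΩ).comp e.symm.injective
  have hjd : DenseRange j :=
    (denseRange_toL2 hΩ).comp e.symm.surjective.denseRange (toL2 Ω).continuous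
  have hS := adjoint_waveOp j
  have hinj := waveOp_injective hj hjd
  obtain ⟨G, h1, h2, h3, h4, h5, h6⟩ := exists_unitaryGroup hS hinj
  exact ⟨{
    W := W
    complete := hW
    e := e
    e_apply := he
    S := waveOp j
    G := G
    S_skew := inner_apply_of_skew hS
    S_dense := denseRange_of_skew hS hinj
    inner_S_fst := fun x u => by
      rw [waveOp_fst, inner_neg_left, ContinuousLinearMap.adjoint_inner_left]
      simp [j]
    S_snd := fun x => rfl
    norm_G := h1
    G_zero := h2
    G_neg := h3
    G_S := h4
    continuous_G := h5
    hasDerivAt_G := h6 }⟩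

/-! ### Free waves at both regularity levels -/

namespace WaveGroup

variable (𝔊 : WaveGroup Ω)

/-- The energy space. -/
abbrev State : Type := WithLp 2 (𝔊.W × L2 Ω)

/-- The displacement of a state. -/
def pos : 𝔊.State →L[ℝ] H01 Ω :=
  (𝔊.e.symm : 𝔊.W →L[ℝ] H01 Ω).comp (WithLp.fstL 2 ℝ 𝔊.W (L2 Ω))

/-- The velocity of a state. -/
def vel : 𝔊.State →L[ℝ] L2 Ω := WithLp.sndL 2 ℝ 𝔊.W (L2 Ω)

/-- The state with given displacement and velocity. -/
def ofData : H01 Ω × L2 Ω →L[ℝ] 𝔊.State :=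
  ((WithLp.prodContinuousLinearEquiv 2 ℝ 𝔊.W (L2 Ω)).symm : 𝔊.W × L2 Ω →L[ℝ] 𝔊.State).comp
    ((𝔊.e : H01 Ω →L[ℝ] 𝔊.W).prodMap (ContinuousLinearMap.id ℝ (L2 Ω)))

@[simp] theorem pos_ofData (p : H01 Ω × L2 Ω) : 𝔊.pos (𝔊.ofData p) = p.1 := 𝔊.e.symm_apply_apply p.1

@[simp] theorem vel_ofData (p : H01 Ω × L2 Ω) : 𝔊.vel (𝔊.ofData p) = p.2 := rfl

theorem state_ext {x y : 𝔊.State} (h1 : 𝔊.pos x = 𝔊.pos y) (h2 : 𝔊.vel x = 𝔊.vel y) : x = y :=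
  (WithLp.equiv 2 _).injective (Prod.ext (𝔊.e.symm.injective h1) h2)

theorem ofData_pos_vel (x : 𝔊.State) : 𝔊.ofData (𝔊.pos x, 𝔊.vel x) = x :=
  𝔊.state_ext (by simp) (by simp)

theorem e_pos (x : 𝔊.State) : 𝔊.e (𝔊.pos x) = x.fst := 𝔊.e.apply_symm_apply _

theorem inner_eq (x y : 𝔊.State) :
    ⟪x, y⟫ = ⟪grad Ω (𝔊.pos x), grad Ω (𝔊.pos y)⟫ + ⟪𝔊.vel x, 𝔊.vel y⟫ := by
  rw [WithLp.prod_inner_apply, ← 𝔊.e_apply, ← 𝔊.e_apply, e_pos, e_pos]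
  rfl

theorem inner_grad_pos_S (x : 𝔊.State) (u : H01 Ω) :
    ⟪grad Ω (𝔊.pos (𝔊.S x)), grad Ω u⟫ = -⟪𝔊.vel x, toL2 Ω u⟫ := by
  rw [← 𝔊.e_apply, ← 𝔊.e_apply, e_pos]
  exact 𝔊.inner_S_fst x u

theorem vel_S (x : 𝔊.State) : 𝔊.vel (𝔊.S x) = toL2 Ω (𝔊.pos x) := 𝔊.S_snd x

theorem isNegLaplacian_pos_S (x : 𝔊.State) : IsNegLaplacian Ω (𝔊.pos (𝔊.S x)) (-𝔊.vel x) :=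
  fun φ => by rw [inner_grad_pos_S, inner_neg_left]

theorem H01_ext_inner (𝔊 : WaveGroup Ω) {u v : H01 Ω} (h : ∀ φ, ⟪grad Ω u, grad Ω φ⟫ = ⟪grad Ω v, grad Ω φ⟫) :
    u = v := by
  have h1 : ⟪grad Ω (u - v), grad Ω (u - v)⟫ = 0 := by
    rw [map_sub, inner_sub_left, ← map_sub, h (u - v), sub_self]
  rw [inner_self_eq_zero, ← 𝔊.e_apply, Submodule.coe_eq_zero] at h1
  exact sub_eq_zero.1 ((map_eq_zero_iff _ 𝔊.e.injective).1 h1)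

/-- Says that `S` inverts `(w, w') ↦ (w', Δw)`; this identifies an arbitrary dual solution as a
trajectory for the generator `S⁻¹`. -/
theorem S_ofData_of_isNegLaplacian {w w' : H01 Ω} {f : L2 Ω} (h : IsNegLaplacian Ω w f) :
    𝔊.S (𝔊.ofData (w', -f)) = 𝔊.ofData (w, toL2 Ω w') := by
  refine 𝔊.state_ext (𝔊.H01_ext_inner fun φ => ?_) (by simp [vel_S])
  rw [inner_grad_pos_S, vel_ofData, pos_ofData, inner_neg_left, neg_neg, h φ]

theorem isDualSolution (t : ℝ) (x : 𝔊.State) :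
    IsDualSolution Ω t (fun s => 𝔊.pos (𝔊.G s (𝔊.S x))) (fun s => 𝔊.pos (𝔊.G s x)) where
  hasDeriv s _ := (𝔊.pos.hasFDerivAt.comp_hasDerivAt s (𝔊.hasDerivAt_G s x)).hasDerivWithinAt
  cont_deriv := (𝔊.pos.continuous.comp (𝔊.continuous_G x)).continuousOn
  wave := by
    refine ⟨fun s => -𝔊.vel (𝔊.G s x),
      (𝔊.vel.continuous.comp (𝔊.continuous_G x)).neg.continuousOn, fun s _ => ⟨?_, ?_⟩⟩
    · rw [𝔊.G_S]
      exact 𝔊.isNegLaplacian_pos_S _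
    · simp only [neg_neg, ← vel_S, ← 𝔊.G_S]
      exact (𝔊.vel.hasFDerivAt.comp_hasDerivAt s (𝔊.hasDerivAt_G s x)).hasDerivWithinAt

theorem exists_isDualSolution (t : ℝ) (x : 𝔊.State) :
    ∃ w w', IsDualSolution Ω t w w' ∧ w t = 𝔊.pos (𝔊.S x) ∧ w' t = 𝔊.pos x :=
  ⟨_, _, 𝔊.isDualSolution t (𝔊.G (-t) x), by simp only [𝔊.G_S, 𝔊.G_neg], by simp only [𝔊.G_neg]⟩

/-- The energy inner product of a trajectory of the group with a dual solution is conserved. -/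
theorem inner_G_dual {t : ℝ} (ht : 0 ≤ t) {w w' : ℝ → H01 Ω} (hw : IsDualSolution Ω t w w')
    (x : 𝔊.State) :
    ⟪𝔊.G t x, 𝔊.ofData (w t, toL2 Ω (w' t))⟫ = ⟪x, 𝔊.ofData (w 0, toL2 Ω (w' 0))⟫ := by
  -- Trajectories are differentiable only when they start in the range of `S`; both sides are
  -- continuous in `x`.
  refine 𝔊.S_dense.induction_on (p := fun x =>
    ⟪𝔊.G t x, 𝔊.ofData (w t, toL2 Ω (w' t))⟫ = ⟪x, 𝔊.ofData (w 0, toL2 Ω (w' 0))⟫) x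
    (isClosed_eq (by fun_prop) (by fun_prop)) fun x => ?_
  obtain ⟨f, -, hf⟩ := hw.wave
  have hder : ∀ s ∈ Icc 0 t,
      HasDerivWithinAt (fun s => ⟪𝔊.G s (𝔊.S x), 𝔊.ofData (w s, toL2 Ω (w' s))⟫) 0 (Icc 0 t) s := by
    intro s hs
    have h1 := 𝔊.ofData.hasFDerivAt.comp_hasDerivWithinAt s ((hw.hasDeriv s hs).prodMk (hf s hs).2)
    have h2 := (𝔊.hasDerivAt_G s x).hasDerivWithinAt (s := Icc 0 t) |>.inner ℝ h1
    convert! h2 using 1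
    have h3 := 𝔊.S_ofData_of_isNegLaplacian (w' := w' s) (hf s hs).1
    change 0 = ⟪𝔊.G s (𝔊.S x), 𝔊.ofData (w' s, -f s)⟫ + ⟪𝔊.G s x, 𝔊.ofData (w s, toL2 Ω (w' s))⟫
    -- Both terms now contain `S`, and skewness cancels them.
    rw [← h3, 𝔊.G_S, 𝔊.S_skew]
    ring
  have h := constant_of_has_deriv_right_zero (fun s hs => (hder s hs).continuousWithinAt)
    (fun s hs => ((hder s (Ico_subset_Icc_self hs)).mono_of_mem_nhdsWithin
      (Icc_mem_nhdsGE_of_mem hs))) t (right_mem_Icc.2 ht)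
  rw [h, 𝔊.G_zero]
  rfl

/-- Homogeneous solutions of finite energy. -/
theorem isEnergySolution (T : ℝ) (x : 𝔊.State) :
    IsEnergySolution Ω T (fun _ => 0) (𝔊.pos x) (𝔊.vel x) (fun t => 𝔊.pos (𝔊.G t x))
      (fun t => 𝔊.vel (𝔊.G t x)) where
  cont := (𝔊.pos.continuous.comp (𝔊.continuous_G x)).continuousOn
  cont_deriv := (𝔊.vel.continuous.comp (𝔊.continuous_G x)).continuousOn
  hasDeriv t _ := by
    simp only [← vel_S, ← 𝔊.G_S]
    exact (𝔊.vel.hasFDerivAt.comp_hasDerivAt t (𝔊.hasDerivAt_G t x)).hasDerivWithinAt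
  init := by simp [𝔊.G_zero]
  init_deriv := by simp [𝔊.G_zero]
  transposition t ht w w' hw := by
    -- Starting from `S x` turns the energy inner product into the weaker `L²` pairing of the
    -- transposition identity.
    have h := 𝔊.inner_G_dual ht.1 hw (𝔊.S x)
    rw [inner_eq, inner_eq, 𝔊.G_S, inner_grad_pos_S, inner_grad_pos_S, vel_S, vel_S] at h
    simp only [pos_ofData, vel_ofData] at h
    simp only [inner_zero_left, intervalIntegral.integral_zero, add_zero]
    linarith

theorem toHneg1_vel (x : 𝔊.State) : toHneg1 Ω (𝔊.vel x) = -formOp (grad Ω) (𝔊.pos (𝔊.S x)) := by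
  ext φ
  rw [neg_apply, formOp_apply, inner_grad_pos_S, neg_neg]
  rfl

/-- Riesz representation for the Dirichlet inner product: every datum in `L² × H^{-1}` is
`(velocity, Δ displacement)` of some state. -/
theorem exists_state_formOp (z0 : L2 Ω) (z1 : Hneg1 Ω) :
    ∃ x : 𝔊.State, 𝔊.vel x = z0 ∧ -formOp (grad Ω) (𝔊.pos x) = z1 := by
  have := 𝔊.complete
  let p : 𝔊.W := (InnerProductSpace.toDual ℝ 𝔊.W).symm
    (z1.comp (𝔊.e.symm : 𝔊.W →L[ℝ] H01 Ω))
  refine ⟨𝔊.ofData (-𝔊.e.symm p, z0), by simp, ?_⟩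
  ext φ
  rw [neg_apply, formOp_apply, pos_ofData, map_neg, inner_neg_left, neg_neg,
    ← 𝔊.e_apply, ← 𝔊.e_apply, ContinuousLinearEquiv.apply_symm_apply, ← Submodule.coe_inner,
    InnerProductSpace.toDual_symm_apply]
  simp

/-- Homogeneous solutions in `L² × H^{-1}`. -/
theorem isBoundarySolution (T : ℝ) (x : 𝔊.State) :
    IsBoundarySolution Ω T (fun _ => 0) (fun _ => 0) (𝔊.vel x) (-formOp (grad Ω) (𝔊.pos x))
      (fun t => 𝔊.vel (𝔊.G t x)) (fun t => -formOp (grad Ω) (𝔊.pos (𝔊.G t x))) where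
  cont := (𝔊.vel.continuous.comp (𝔊.continuous_G x)).continuousOn
  cont_deriv := (continuous_neg_formOp (grad Ω)
    (𝔊.pos.continuous.comp (𝔊.continuous_G x))).continuousOn
  hasDeriv t _ := by
    simp only [toHneg1_vel, ← 𝔊.G_S]
    exact hasDerivWithinAt_neg_formOp (grad Ω)
      (𝔊.pos.hasFDerivAt.comp_hasDerivAt t (𝔊.hasDerivAt_G t x))
  init := by simp [𝔊.G_zero]
  init_deriv := by simp [𝔊.G_zero]
  transposition t ht w w' hw := by
    -- Here no `S` is needed: the energy inner product itself is the pairing of `L² × H^{-1}` with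
    -- the dual data.
    have h := 𝔊.inner_G_dual ht.1 hw x
    rw [inner_eq, inner_eq] at h
    simp only [pos_ofData, vel_ofData] at h
    simp only [inner_zero_left, intervalIntegral.integral_zero, add_zero, sub_zero,
      neg_apply, formOp_apply]
    linarith

/-- The final states of dual solutions separate points. -/
theorem eq_zero_of_forall_state (hΩ : IsOpen Ω) {f : L2 Ω} {ℓ : Hneg1 Ω}
    (h1 : ∀ x : 𝔊.State, ℓ (𝔊.pos (𝔊.S x)) - ⟪f, toL2 Ω (𝔊.pos x)⟫ = 0) :
    f = 0 ∧ ℓ = 0 := by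
  have hf : f = 0 := by
    refine (denseRange_toL2 hΩ).eq_zero_of_inner_left (𝕜 := ℝ) ?_
    intro u
    -- A state with zero velocity is sent by `S` to one with zero displacement, so `ℓ` drops out and
    -- `f` is isolated.
    have h2 := h1 (𝔊.ofData (u, 0))
    have h3 : 𝔊.pos (𝔊.S (𝔊.ofData (u, 0))) = 0 := 𝔊.H01_ext_inner fun φ => by
      rw [inner_grad_pos_S]; simp
    rw [h3, map_zero, pos_ofData] at h2
    linarith
  refine ⟨hf, ?_⟩
  subst hf
  have h2 : ∀ x : 𝔊.State, ℓ (𝔊.pos x) = 0 := fun x =>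
    𝔊.S_dense.induction_on (p := fun x => ℓ (𝔊.pos x) = 0) x
      (isClosed_eq (by fun_prop) continuous_const) fun x => by
        have := h1 x
        rwa [inner_zero_left, sub_zero] at this
  ext u
  simpa using h2 (𝔊.ofData (u, 0))

theorem eq_zero_of_forall_dual (𝔊 : WaveGroup Ω) (hΩ : IsOpen Ω) {t : ℝ} {f : L2 Ω} {ℓ : Hneg1 Ω}
    (h : ∀ w w', IsDualSolution Ω t w w' → ℓ (w t) - ⟪f, toL2 Ω (w' t)⟫ = 0) :
    f = 0 ∧ ℓ = 0 :=
  𝔊.eq_zero_of_forall_state hΩ fun x => by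
    obtain ⟨w, w', hw, e1, e2⟩ := 𝔊.exists_isDualSolution t x
    rw [← e1, ← e2]
    exact h w w' hw

theorem eq_zero_of_toHneg1_eq_zero (hΩ : IsOpen Ω) {f : L2 Ω} (h : toHneg1 Ω f = 0) : f = 0 :=
  (denseRange_toL2 hΩ).eq_zero_of_inner_left (𝕜 := ℝ) fun u =>
    congrArg (fun ℓ : Hneg1 Ω => ℓ u) h

end WaveGroup

/-! ### Superposition and uniqueness -/

theorem IsEnergySolution.add_homogeneous {T : ℝ} {F : ℝ → L2 Ω} {y0 z0 : H01 Ω} {y1 z1 : L2 Ω}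
    {y z : ℝ → H01 Ω} {y' z' : ℝ → L2 Ω} (hy : IsEnergySolution Ω T F y0 y1 y y')
    (hz : IsEnergySolution Ω T (fun _ => 0) z0 z1 z z') :
    IsEnergySolution Ω T F (y0 + z0) (y1 + z1) (fun t => y t + z t) (fun t => y' t + z' t) where
  cont := hy.cont.add hz.cont
  cont_deriv := hy.cont_deriv.add hz.cont_deriv
  hasDeriv t ht := by
    simp only [map_add]
    exact (hy.hasDeriv t ht).add (hz.hasDeriv t ht)
  init := by rw [hy.init, hz.init]
  init_deriv := by rw [hy.init_deriv, hz.init_deriv]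
  transposition t ht w w' hw := by
    have h1 := hy.transposition t ht w w' hw
    have h2 := hz.transposition t ht w w' hw
    simp only [inner_zero_left, intervalIntegral.integral_zero, add_zero] at h2
    simp only [map_add, inner_add_left]
    linarith

theorem toHneg1_add (f g : L2 Ω) : toHneg1 Ω (f + g) = toHneg1 Ω f + toHneg1 Ω g := by
  ext φ
  exact inner_add_left f g _

theorem IsBoundarySolution.add_homogeneous {T : ℝ} {F : ℝ → L2 Ω} {g : ℝ → L2Bdry Ω}
    {y0 z0 : L2 Ω} {y1 z1 : Hneg1 Ω}
    {y z : ℝ → L2 Ω} {y' z' : ℝ → Hneg1 Ω} (hy : IsBoundarySolution Ω T F g y0 y1 y y')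
    (hz : IsBoundarySolution Ω T (fun _ => 0) (fun _ => 0) z0 z1 z z') :
    IsBoundarySolution Ω T F g (y0 + z0) (y1 + z1) (fun t => y t + z t)
      (fun t => y' t + z' t) where
  cont := hy.cont.add hz.cont
  cont_deriv := hy.cont_deriv.add hz.cont_deriv
  hasDeriv t ht := by
    simp only [toHneg1_add]
    exact hasDerivWithinAt_add_dual_submodule (hy.hasDeriv t ht) (hz.hasDeriv t ht)
  init := by rw [hy.init, hz.init]
  init_deriv := by rw [hy.init_deriv, hz.init_deriv]
  transposition t ht w w' hw := by
    have h1 := hy.transposition t ht w w' hw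
    have h2 := hz.transposition t ht w w' hw
    simp only [inner_zero_left, intervalIntegral.integral_zero, add_zero, sub_zero] at h2
    simp only [inner_add_left, add_apply]
    linarith

/-- Subtracting transposition identities leaves the difference of states at time `t` paired to zero
with all final dual states. -/
theorem IsEnergySolution.unique (𝔊 : WaveGroup Ω) (hΩ : IsOpen Ω) {T : ℝ} {F : ℝ → L2 Ω}
    {y0 : H01 Ω} {y1 : L2 Ω} {y z : ℝ → H01 Ω} {y' z' : ℝ → L2 Ω}
    (hy : IsEnergySolution Ω T F y0 y1 y y') (hz : IsEnergySolution Ω T F y0 y1 z z')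
    {t : ℝ} (ht : t ∈ Icc 0 T) : y t = z t ∧ y' t = z' t := by
  have h := 𝔊.eq_zero_of_forall_dual hΩ (t := t) (f := toL2 Ω (y t) - toL2 Ω (z t))
    (ℓ := toHneg1 Ω (y' t - z' t)) fun w w' hw => by
      have h1 := hy.transposition t ht w w' hw
      have h2 := hz.transposition t ht w w' hw
      change ⟪y' t - z' t, toL2 Ω (w t)⟫ - _ = 0
      rw [inner_sub_left, inner_sub_left]
      linarith
  refine ⟨toL2_injective hΩ (sub_eq_zero.1 h.1), sub_eq_zero.1 ?_⟩
  exact WaveGroup.eq_zero_of_toHneg1_eq_zero hΩ h.2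

theorem IsBoundarySolution.unique (𝔊 : WaveGroup Ω) (hΩ : IsOpen Ω) {T : ℝ} {F : ℝ → L2 Ω}
    {g : ℝ → L2Bdry Ω} {y0 : L2 Ω} {y1 : Hneg1 Ω} {y z : ℝ → L2 Ω} {y' z' : ℝ → Hneg1 Ω}
    (hy : IsBoundarySolution Ω T F g y0 y1 y y') (hz : IsBoundarySolution Ω T F g y0 y1 z z')
    {t : ℝ} (ht : t ∈ Icc 0 T) : y t = z t ∧ y' t = z' t := by
  have h := 𝔊.eq_zero_of_forall_dual hΩ (t := t) (f := y t - z t) (ℓ := y' t - z' t)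
    fun w w' hw => by
      have h1 := hy.transposition t ht w w' hw
      have h2 := hz.transposition t ht w w' hw
      rw [inner_sub_left, sub_apply]
      linarith
  exact ⟨sub_eq_zero.1 h.1, sub_eq_zero.1 h.2⟩

/-! ### Multiplication by a bounded function -/

/-- Multiplication by a bounded function as an operator on `L²(Ω)`. -/
def mulOp {c : Eucl d → ℝ} (hc : MemLp c ∞ (volOn Ω)) : L2 Ω →L[ℝ] L2 Ω :=
  (ContinuousLinearMap.mul ℝ ℝ).holderL (volOn Ω) ∞ 2 2 (hc.toLp c)

theorem coeFn_mulOp {c : Eucl d → ℝ} (hc : MemLp c ∞ (volOn Ω)) (f : L2 Ω) :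
    mulOp hc f =ᵐ[volOn Ω] fun x => c x * f x := by
  refine ((ContinuousLinearMap.mul ℝ ℝ).coeFn_holder (r := 2) (hc.toLp c) f).trans ?_
  filter_upwards [hc.coeFn_toLp] with x hx
  simp [hx]

/-- Essential boundedness rules out the default value, making the multiplication a bounded operator
that preserves continuity in time. -/
theorem mulL2_eq_mulOp {c : Eucl d → ℝ} (hc : MemLp c ∞ (volOn Ω)) (f : L2 Ω) :
    mulL2 c f = mulOp hc f := by
  have h : MemLp (fun x => c x * f x) 2 (volOn Ω) :=
    (memLp_congr_ae (coeFn_mulOp hc f)).1 (Lp.memLp _)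
  rw [mulL2, dif_pos h]
  exact Lp.ext (h.coeFn_toLp.trans (coeFn_mulOp hc f).symm)

theorem inner_mulOp {c : Eucl d → ℝ} (hc : MemLp c ∞ (volOn Ω)) (f g : L2 Ω) :
    ⟪mulOp hc f, g⟫ = ∫ x in Ω, c x * (f x * g x) := by
  rw [L2.inner_def]
  refine integral_congr_ae ?_
  filter_upwards [coeFn_mulOp hc f] with x hx
  rw [hx]
  simp [mul_comm, mul_assoc]

theorem inner_mulOp_comm {c : Eucl d → ℝ} (hc : MemLp c ∞ (volOn Ω)) (f g : L2 Ω) :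
    ⟪mulOp hc f, g⟫ = ⟪mulOp hc g, f⟫ := by
  rw [inner_mulOp, inner_mulOp]
  simp only [mul_comm (f _)]

theorem Phi_eq {T : ℝ} {c : Eucl d → ℝ} (hc : MemLp c ∞ (volOn Ω)) (y : ℝ → L2 Ω) :
    Phi Ω T c y = (1 / 2) * ∫ t in 0..T, ⟪mulOp hc (y t), y t⟫ := by
  simp only [Phi, inner_mulOp, pow_two]

/-- The derivative of `Φ` along an affine family of trajectories. -/
theorem hasDerivAt_Phi {T : ℝ} (hT : 0 < T) {c : Eucl d → ℝ} (hc : MemLp c ∞ (volOn Ω))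
    {y z : ℝ → L2 Ω} {u : ℝ → ℝ → L2 Ω} (hy : ContinuousOn y (Icc 0 T))
    (hz : ContinuousOn z (Icc 0 T)) (hu : ∀ τ, ∀ t ∈ Icc 0 T, u τ t = y t + τ • z t) :
    HasDerivAt (fun τ => Phi Ω T c (u τ)) (∫ t in 0..T, ⟪mulOp hc (y t), z t⟫) 0 := by
  have hI : ∀ {f g : ℝ → L2 Ω}, ContinuousOn f (Icc 0 T) → ContinuousOn g (Icc 0 T) →
      IntervalIntegrable (fun t => ⟪mulOp hc (f t), g t⟫) volume 0 T := fun hf hg =>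
    (((mulOp hc).continuous.comp_continuousOn hf).inner hg).intervalIntegrable_of_Icc hT.le
  have e : (fun τ => Phi Ω T c (u τ)) = fun τ => (1 / 2) * ((∫ t in 0..T, ⟪mulOp hc (y t), y t⟫) +
      (2 * τ) * (∫ t in 0..T, ⟪mulOp hc (y t), z t⟫) +
      τ ^ 2 * ∫ t in 0..T, ⟪mulOp hc (z t), z t⟫) := by
    ext τ
    rw [Phi_eq hc, ← intervalIntegral.integral_const_mul (2 * τ),
      ← intervalIntegral.integral_const_mul (τ ^ 2),
      ← intervalIntegral.integral_add (hI hy hy) ((hI hy hz).const_mul _),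
      ← intervalIntegral.integral_add ((hI hy hy).add ((hI hy hz).const_mul _))
        ((hI hz hz).const_mul _)]
    congr 1
    refine intervalIntegral.integral_congr fun t ht => ?_
    rw [uIcc_of_le hT.le] at ht
    simp only [hu τ t ht, map_add, map_smul, inner_add_left, inner_add_right,
      real_inner_smul_left, real_inner_smul_right, inner_mulOp_comm hc (z t) (y t)]
    ring
  rw [e]
  generalize (∫ t in 0..T, ⟪mulOp hc (y t), y t⟫) = a
  generalize (∫ t in 0..T, ⟪mulOp hc (y t), z t⟫) = b
  generalize (∫ t in 0..T, ⟪mulOp hc (z t), z t⟫) = k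
  have h := ((((hasDerivAt_id (0 : ℝ)).const_mul 2).mul_const b).const_add a).add
    (((hasDerivAt_id (0 : ℝ)).pow 2).mul_const k) |>.const_mul (1 / 2 : ℝ)
  convert! h using 1
  simp

/-! ### Duality between the cascade system and the derivative of `Φ` -/

namespace WaveGroup

variable (𝔊 : WaveGroup Ω)

/-- The functional `x ↦ ∫_0^T ⟪F, v⟫`, where `v` is the velocity of the trajectory starting at
`x`. -/
def pairing {T : ℝ} (hT : 0 < T) {F : ℝ → L2 Ω} (hF : ContinuousOn F (Icc 0 T)) :
    𝔊.State →ₗ[ℝ] ℝ where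
  toFun x := ∫ t in 0..T, ⟪F t, 𝔊.vel (𝔊.G t x)⟫
  map_add' x y := by
    have hI : ∀ x, IntervalIntegrable (fun t => ⟪F t, 𝔊.vel (𝔊.G t x)⟫) volume 0 T := fun x =>
      (hF.inner (𝔊.vel.continuous.comp
        (𝔊.continuous_G x)).continuousOn).intervalIntegrable_of_Icc hT.le
    rw [← intervalIntegral.integral_add (hI x) (hI y)]
    simp only [map_add, inner_add_right]
  map_smul' a x := by
    simp only [map_smul, real_inner_smul_right, RingHom.id_apply, smul_eq_mul,
      intervalIntegral.integral_const_mul]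

theorem pairing_apply {T : ℝ} (hT : 0 < T) {F : ℝ → L2 Ω} (hF : ContinuousOn F (Icc 0 T))
    (x : 𝔊.State) : 𝔊.pairing hT hF x = ∫ t in 0..T, ⟪F t, 𝔊.vel (𝔊.G t x)⟫ := rfl

theorem pairing_S {T : ℝ} (hT : 0 < T) {F : ℝ → L2 Ω} (hF : ContinuousOn F (Icc 0 T))
    (x : 𝔊.State) : 𝔊.pairing hT hF (𝔊.S x) = ∫ t in 0..T, ⟪F t, toL2 Ω (𝔊.pos (𝔊.G t x))⟫ := by
  simp only [pairing_apply, 𝔊.G_S, vel_S]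

theorem continuous_pairing {T : ℝ} (hT : 0 < T) {F : ℝ → L2 Ω} (hF : ContinuousOn F (Icc 0 T)) :
    Continuous (𝔊.pairing hT hF) := by
  obtain ⟨C, hC⟩ := isCompact_Icc.exists_bound_of_continuousOn hF
  refine AddMonoidHomClass.continuous_of_bound (𝔊.pairing hT hF) (C * ‖𝔊.vel‖ * |T - 0|)
    fun x => ?_
  have h := intervalIntegral.norm_integral_le_of_norm_le_const (a := 0) (b := T)
    (f := fun t => ⟪F t, 𝔊.vel (𝔊.G t x)⟫) (C := C * (‖𝔊.vel‖ * ‖x‖)) fun t ht => by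
      rw [uIoc_of_le hT.le] at ht
      have h1 := hC t (Ioc_subset_Icc_self ht)
      have h2 := 𝔊.vel.le_opNorm (𝔊.G t x)
      rw [𝔊.norm_G] at h2
      exact (norm_inner_le_norm _ _).trans
        (mul_le_mul h1 h2 (norm_nonneg _) ((norm_nonneg _).trans h1))
  refine h.trans_eq ?_
  ring

theorem eq_zero_of_comp_S {A : 𝔊.State →ₗ[ℝ] ℝ} (hA : Continuous A) (h : ∀ x, A (𝔊.S x) = 0)
    (x : 𝔊.State) : A x = 0 :=
  𝔊.S_dense.induction_on (p := fun x => A x = 0) x (isClosed_eq hA continuous_const) h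

/-- The solution with source `F` and zero initial data is at rest at time `T` if and only if `F` is
orthogonal to the velocities of all free trajectories. -/
theorem rest_iff_pairing_eq_zero (hΩ : IsOpen Ω) {T : ℝ} (hT : 0 < T) {F : ℝ → L2 Ω}
    (hF : ContinuousOn F (Icc 0 T)) {Y : ℝ → H01 Ω} {Y' : ℝ → L2 Ω}
    (hY : IsEnergySolution Ω T F 0 0 Y Y') :
    (Y T = 0 ∧ Y' T = 0) ↔ ∀ x, 𝔊.pairing hT hF x = 0 := by
  have hTm : T ∈ Icc 0 T := right_mem_Icc.2 hT.le
  constructor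
  · rintro ⟨h1, h2⟩
    -- Dual solutions only test the pairing on the range of `S²`: one `S` from their regularity, one
    -- from reading a displacement as a velocity. Density is therefore used twice.
    refine 𝔊.eq_zero_of_comp_S (𝔊.continuous_pairing hT hF) fun x => ?_
    refine 𝔊.eq_zero_of_comp_S (A := (𝔊.pairing hT hF).comp (𝔊.S : 𝔊.State →ₗ[ℝ] 𝔊.State))
      ((𝔊.continuous_pairing hT hF).comp 𝔊.S.continuous) (fun x => ?_) x
    have h := hY.transposition T hTm _ _ (𝔊.isDualSolution T x)
    rw [h1, h2] at h
    simp only [map_zero, inner_zero_left, sub_zero, zero_add] at h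
    exact (𝔊.pairing_S hT hF (𝔊.S x)).trans h.symm
  · intro h0
    have h := 𝔊.eq_zero_of_forall_state hΩ (f := toL2 Ω (Y T)) (ℓ := toHneg1 Ω (Y' T)) fun x => by
      -- Starting from `G (-T) x` makes the final dual state the one prescribed by `x`.
      have h1 := hY.transposition T hTm _ _ (𝔊.isDualSolution T (𝔊.G (-T) x))
      have h2 := 𝔊.pairing_S hT hF (𝔊.S (𝔊.G (-T) x))
      rw [h0] at h2
      rw [← h2] at h1
      simp only [𝔊.G_S, 𝔊.G_neg, map_zero, inner_zero_left, sub_zero, add_zero] at h1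
      exact h1
    exact ⟨toL2_injective hΩ (h.1.trans (map_zero _).symm), eq_zero_of_toHneg1_eq_zero hΩ h.2⟩

end WaveGroup

/-! ### Stationarity of `Φ` -/

theorem isStationary_iff {T : ℝ} (hT : 0 < T) {c : Eucl d → ℝ} (hc : MemLp c ∞ (volOn Ω))
    {S : ℝ → ℝ → Set (ℝ → L2 Ω)} {u p q : ℝ → L2 Ω} (hu : ContinuousOn u (Icc 0 T))
    (hp : ContinuousOn p (Icc 0 T)) (hq : ContinuousOn q (Icc 0 T))
    (hmem : ∀ τ₀ τ₁ : ℝ, (fun t => u t + (τ₀ • p t + τ₁ • q t)) ∈ S τ₀ τ₁)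
    (huniq : ∀ τ₀ τ₁ : ℝ, ∀ y ∈ S τ₀ τ₁, ∀ t ∈ Icc 0 T, y t = u t + (τ₀ • p t + τ₁ • q t)) :
    IsStationary Ω T c S ↔ (∫ t in 0..T, ⟪mulOp hc (u t), p t⟫) = 0 ∧
      (∫ t in 0..T, ⟪mulOp hc (u t), q t⟫) = 0 := by
  have hp' : ∀ y : ℝ → ℝ → ℝ → L2 Ω, (∀ τ₀ τ₁, y τ₀ τ₁ ∈ S τ₀ τ₁) →
      HasDerivAt (fun τ₀ => Phi Ω T c (y τ₀ 0)) (∫ t in 0..T, ⟪mulOp hc (u t), p t⟫) 0 :=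
    fun y hy => hasDerivAt_Phi hT hc hu hp fun τ t ht => by
      rw [huniq τ 0 _ (hy τ 0) t ht, zero_smul, add_zero]
  have hq' : ∀ y : ℝ → ℝ → ℝ → L2 Ω, (∀ τ₀ τ₁, y τ₀ τ₁ ∈ S τ₀ τ₁) →
      HasDerivAt (fun τ₁ => Phi Ω T c (y 0 τ₁)) (∫ t in 0..T, ⟪mulOp hc (u t), q t⟫) 0 :=
    fun y hy => hasDerivAt_Phi hT hc hu hq fun τ t ht => by
      rw [huniq 0 τ _ (hy 0 τ) t ht, zero_smul, zero_add]
  constructor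
  · rintro ⟨-, h⟩
    obtain ⟨h1, h2⟩ := h _ hmem
    exact ⟨(hp' _ hmem).unique h1, (hq' _ hmem).unique h2⟩
  · rintro ⟨h1, h2⟩
    refine ⟨fun τ₀ τ₁ => ⟨_, hmem τ₀ τ₁⟩, fun y hy => ⟨?_, ?_⟩⟩
    · simpa only [h1] using hp' y hy
    · simpa only [h2] using hq' y hy

/-! ### Insensitization as orthogonality to free waves -/

namespace WaveGroup

variable (𝔊 : WaveGroup Ω)

theorem continuousOn_neg_mulL2 {T : ℝ} {c : Eucl d → ℝ} (hc : MemLp c ∞ (volOn Ω)) {u : ℝ → L2 Ω}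
    (hu : ContinuousOn u (Icc 0 T)) : ContinuousOn (fun t => -mulL2 c (u t)) (Icc 0 T) := by
  simp only [mulL2_eq_mulOp hc]
  exact ((mulOp hc).continuous.comp_continuousOn hu).neg

theorem integral_mulOp_vel_eq_zero_iff {T : ℝ} (hT : 0 < T) {c : Eucl d → ℝ}
    (hc : MemLp c ∞ (volOn Ω)) {u : ℝ → L2 Ω} (hu : ContinuousOn u (Icc 0 T)) (x : 𝔊.State) :
    (∫ t in 0..T, ⟪mulOp hc (u t), 𝔊.vel (𝔊.G t x)⟫) = 0 ↔
      𝔊.pairing hT (continuousOn_neg_mulL2 hc hu) x = 0 := by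
  rw [← neg_eq_zero, ← intervalIntegral.integral_neg, pairing_apply]
  simp only [mulL2_eq_mulOp hc, inner_neg_left]

theorem ofData_add_ofData (x : 𝔊.State) :
    𝔊.ofData (𝔊.pos x, 0) + 𝔊.ofData (0, 𝔊.vel x) = x := by
  rw [← map_add, Prod.mk_add_mk, add_zero, zero_add, ofData_pos_vel]

/-- Perturbations in `H_0^1 × L²` are displacements of free waves, so they test the pairing only on
the range of `S`; continuity gives the rest. -/
theorem insensitizesInterior_iff (hΩ : IsOpen Ω) {T : ℝ} (hT : 0 < T) {c b : Eucl d → ℝ}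
    (hc : MemLp c ∞ (volOn Ω)) {ξ v : ℝ → L2 Ω} {y0 : H01 Ω} {y1 : L2 Ω} {Y : ℝ → H01 Ω}
    {Y' : ℝ → L2 Ω} (hY : IsEnergySolution Ω T (fun t => ξ t + mulL2 b (v t)) y0 y1 Y Y')
    (hu : ContinuousOn (fun t => toL2 Ω (Y t)) (Icc 0 T)) :
    InsensitizesInterior Ω T c b ξ v y0 y1 ↔
      ∀ x, 𝔊.pairing hT (continuousOn_neg_mulL2 hc hu) x = 0 := by
  have key : ∀ x : 𝔊.State, IsStationary Ω T c (fun τ₀ τ₁ =>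
      {u | ∃ (y : ℝ → H01 Ω) (y' : ℝ → L2 Ω),
        IsEnergySolution Ω T (fun t => ξ t + mulL2 b (v t)) (y0 + τ₀ • 𝔊.pos x)
          (y1 + τ₁ • 𝔊.vel x) y y' ∧ u = fun t => toL2 Ω (y t)}) ↔
      𝔊.pairing hT (continuousOn_neg_mulL2 hc hu) (𝔊.S (𝔊.ofData (𝔊.pos x, 0))) = 0 ∧
      𝔊.pairing hT (continuousOn_neg_mulL2 hc hu) (𝔊.S (𝔊.ofData (0, 𝔊.vel x))) = 0 := by
    intro x
    have hsol : ∀ τ₀ τ₁ : ℝ, ∃ (y : ℝ → H01 Ω) (y' : ℝ → L2 Ω),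
        IsEnergySolution Ω T (fun t => ξ t + mulL2 b (v t)) (y0 + τ₀ • 𝔊.pos x)
          (y1 + τ₁ • 𝔊.vel x) y y' ∧ ∀ t, toL2 Ω (y t) = toL2 Ω (Y t) +
            (τ₀ • 𝔊.vel (𝔊.G t (𝔊.S (𝔊.ofData (𝔊.pos x, 0)))) +
              τ₁ • 𝔊.vel (𝔊.G t (𝔊.S (𝔊.ofData (0, 𝔊.vel x))))) := by
      intro τ₀ τ₁
      -- Displacement and velocity are perturbed by separate states, so that the family is affine in
      -- each amplitude.
      have h := hY.add_homogeneous (𝔊.isEnergySolution T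
        (τ₀ • 𝔊.ofData (𝔊.pos x, 0) + τ₁ • 𝔊.ofData (0, 𝔊.vel x)))
      rw [show 𝔊.pos (τ₀ • 𝔊.ofData (𝔊.pos x, 0) + τ₁ • 𝔊.ofData (0, 𝔊.vel x)) = τ₀ • 𝔊.pos x by
        simp, show 𝔊.vel (τ₀ • 𝔊.ofData (𝔊.pos x, 0) + τ₁ • 𝔊.ofData (0, 𝔊.vel x)) = τ₁ • 𝔊.vel x
        by simp] at h
      exact ⟨_, _, h, fun t => by simp only [map_add, map_smul, 𝔊.G_S, vel_S]⟩
    refine (isStationary_iff hT hc hu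
      (𝔊.vel.continuous.comp (𝔊.continuous_G (𝔊.S (𝔊.ofData (𝔊.pos x, 0))))).continuousOn
      (𝔊.vel.continuous.comp (𝔊.continuous_G (𝔊.S (𝔊.ofData (0, 𝔊.vel x))))).continuousOn
      ?_ ?_).trans (and_congr (𝔊.integral_mulOp_vel_eq_zero_iff hT hc hu _)
        (𝔊.integral_mulOp_vel_eq_zero_iff hT hc hu _))
    · intro τ₀ τ₁
      obtain ⟨y, y', h1, h2⟩ := hsol τ₀ τ₁
      exact ⟨y, y', h1, funext fun t => (h2 t).symm⟩
    · rintro τ₀ τ₁ _ ⟨z, z', hz, rfl⟩ t ht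
      obtain ⟨y, y', h1, h2⟩ := hsol τ₀ τ₁
      exact (congrArg (toL2 Ω) (hz.unique 𝔊 hΩ h1 ht).1).trans (h2 t)
  constructor
  · intro h
    refine 𝔊.eq_zero_of_comp_S (𝔊.continuous_pairing hT _) fun x => ?_
    obtain ⟨h1, h2⟩ := (key x).1 (h (𝔊.pos x) (𝔊.vel x))
    rw [← 𝔊.ofData_add_ofData x, map_add, map_add, h1, h2, add_zero]
  · intro h z0 z1
    have h1 := (key (𝔊.ofData (z0, z1))).2 ⟨h _, h _⟩
    simpa only [pos_ofData, vel_ofData] using h1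

theorem neg_formOp_smul (a : ℝ) (u : H01 Ω) :
    (-formOp (grad Ω) (a • u) : Hneg1 Ω) = a • -formOp (grad Ω) u := by
  ext φ
  simp only [neg_apply, smul_apply, formOp_apply, map_smul, smul_eq_mul,
    mul_neg]

/-- Perturbations in `L² × H^{-1}` are velocities of arbitrary free waves, so the pairing is tested
on every state without a density argument. The perturbation of `y⁰` is the velocity component, that
of `y¹` comes from the displacement. -/
theorem insensitizesBoundary_iff (hΩ : IsOpen Ω) {T : ℝ} (hT : 0 < T) {c b : Eucl d → ℝ}
    (hc : MemLp c ∞ (volOn Ω)) {ξ : ℝ → L2 Ω} {v : ℝ → L2Bdry Ω} {y0 : L2 Ω} {y1 : Hneg1 Ω}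
    {Y : ℝ → L2 Ω} {Y' : ℝ → Hneg1 Ω}
    (hY : IsBoundarySolution Ω T ξ (fun t => mulL2 b (v t)) y0 y1 Y Y') :
    InsensitizesBoundary Ω T c b ξ v y0 y1 ↔
      ∀ x, 𝔊.pairing hT (continuousOn_neg_mulL2 hc hY.cont) x = 0 := by
  have key : ∀ x : 𝔊.State, IsStationary Ω T c (fun τ₀ τ₁ =>
      {u | ∃ y' : ℝ → Hneg1 Ω,
        IsBoundarySolution Ω T ξ (fun t => mulL2 b (v t)) (y0 + τ₀ • 𝔊.vel x)
          (y1 + τ₁ • -formOp (grad Ω) (𝔊.pos x)) u y'}) ↔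
      𝔊.pairing hT (continuousOn_neg_mulL2 hc hY.cont) (𝔊.ofData (0, 𝔊.vel x)) = 0 ∧
      𝔊.pairing hT (continuousOn_neg_mulL2 hc hY.cont) (𝔊.ofData (𝔊.pos x, 0)) = 0 := by
    intro x
    have hsol : ∀ τ₀ τ₁ : ℝ, ∃ y' : ℝ → Hneg1 Ω,
        IsBoundarySolution Ω T ξ (fun t => mulL2 b (v t)) (y0 + τ₀ • 𝔊.vel x)
          (y1 + τ₁ • -formOp (grad Ω) (𝔊.pos x)) (fun t => Y t +
            (τ₀ • 𝔊.vel (𝔊.G t (𝔊.ofData (0, 𝔊.vel x))) +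
              τ₁ • 𝔊.vel (𝔊.G t (𝔊.ofData (𝔊.pos x, 0))))) y' := by
      intro τ₀ τ₁
      have h := hY.add_homogeneous (𝔊.isBoundarySolution T
        (τ₀ • 𝔊.ofData (0, 𝔊.vel x) + τ₁ • 𝔊.ofData (𝔊.pos x, 0)))
      rw [show 𝔊.vel (τ₀ • 𝔊.ofData (0, 𝔊.vel x) + τ₁ • 𝔊.ofData (𝔊.pos x, 0)) = τ₀ • 𝔊.vel x by
        simp, show 𝔊.pos (τ₀ • 𝔊.ofData (0, 𝔊.vel x) + τ₁ • 𝔊.ofData (𝔊.pos x, 0)) = τ₁ • 𝔊.pos x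
        by simp, neg_formOp_smul] at h
      simp only [map_add, map_smul] at h
      exact ⟨_, h⟩
    refine (isStationary_iff hT hc hY.cont
      (𝔊.vel.continuous.comp (𝔊.continuous_G (𝔊.ofData (0, 𝔊.vel x)))).continuousOn
      (𝔊.vel.continuous.comp (𝔊.continuous_G (𝔊.ofData (𝔊.pos x, 0)))).continuousOn
      ?_ ?_).trans (and_congr (𝔊.integral_mulOp_vel_eq_zero_iff hT hc hY.cont _)
        (𝔊.integral_mulOp_vel_eq_zero_iff hT hc hY.cont _))
    · exact hsol
    · rintro τ₀ τ₁ z ⟨z', hz⟩ t ht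
      obtain ⟨y', h1⟩ := hsol τ₀ τ₁
      exact (hz.unique 𝔊 hΩ h1 ht).1
  constructor
  · intro h x
    obtain ⟨h1, h2⟩ := (key x).1 (h (𝔊.vel x) (-formOp (grad Ω) (𝔊.pos x)))
    rw [← 𝔊.ofData_add_ofData x, map_add, h1, h2, add_zero]
  · intro h z0 z1
    obtain ⟨x, rfl, rfl⟩ := 𝔊.exists_state_formOp z0 z1
    exact (key x).2 ⟨h _, h _⟩

end WaveGroup

end InsensitizingWave

end

open InsensitizingWave in
theorem proposition4p1 (d : ℕ) (hd : 1 ≤ d) (Ω : Set (Eucl d)) (hΩ : IsOpen Ω)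
    (hΩb : Bornology.IsBounded Ω) (hΓ : HasC2Boundary Ω) (T : ℝ) (hT : 0 < T)
    (c : Eucl d → ℝ) (hc : IsW1Infty Ω c) (ξ : ℝ → L2 Ω) (hξ : IsL2Time T ξ) :
    -- locally distributed control
    (∀ (y0 : H01 Ω) (y1 : L2 Ω) (b : Eucl d → ℝ), ContinuousOn b (closure Ω) →
      ∀ v : ℝ → L2 Ω, IsL2Time T v →
      ∀ (Y₁ Y₂ : ℝ → H01 Ω) (Y₁' Y₂' : ℝ → L2 Ω),
        IsCascadeInterior Ω T c b ξ v y0 y1 Y₁ Y₂ Y₁' Y₂' →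
        ((Y₁ T = 0 ∧ Y₁' T = 0) ↔ InsensitizesInterior Ω T c b ξ v y0 y1) ∧
        (Y₁ T = 0 ∧ Y₂ T = 0 ∧ Y₁' T = 0 ∧ Y₂' T = 0 →
          DrivesToRestInterior Ω T b ξ v y0 y1 ∧ InsensitizesInterior Ω T c b ξ v y0 y1)) ∧
    -- boundary control
    (∀ (y0 : L2 Ω) (y1 : Hneg1 Ω) (b : Eucl d → ℝ), ContinuousOn b (frontier Ω) →
      ∀ v : ℝ → L2Bdry Ω, IsL2Time T v →
      ∀ (Y₁ : ℝ → H01 Ω) (Y₂ : ℝ → L2 Ω) (Y₁' : ℝ → L2 Ω) (Y₂' : ℝ → Hneg1 Ω),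
        IsCascadeBoundary Ω T c b ξ v y0 y1 Y₁ Y₂ Y₁' Y₂' →
        ((Y₁ T = 0 ∧ Y₁' T = 0) ↔ InsensitizesBoundary Ω T c b ξ v y0 y1) ∧
        (Y₁ T = 0 ∧ Y₂ T = 0 ∧ Y₁' T = 0 ∧ Y₂' T = 0 →
          DrivesToRestBoundary Ω T b ξ v y0 y1 ∧ InsensitizesBoundary Ω T c b ξ v y0 y1)) := by

  obtain ⟨𝔊⟩ := nonempty_waveGroup hd hΩ hΩb
  have hTm : T ∈ Icc 0 T := right_mem_Icc.2 hT.le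
  constructor
  · intro y0 y1 b _ v _ Y₁ Y₂ Y₁' Y₂' ⟨h1, h2⟩
    have hu : ContinuousOn (fun t => toL2 Ω (Y₂ t)) (Icc 0 T) :=
      (toL2 Ω).continuous.comp_continuousOn h2.cont
    have h := (𝔊.rest_iff_pairing_eq_zero hΩ hT (WaveGroup.continuousOn_neg_mulL2 hc.1 hu) h1).trans
      (𝔊.insensitizesInterior_iff hΩ hT hc.1 h2 hu).symm
    refine ⟨h, fun ⟨k1, k2, k3, k4⟩ => ⟨⟨⟨_, _, h2⟩, fun y y' hy => ?_⟩, h.1 ⟨k1, k3⟩⟩⟩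
    obtain ⟨e1, e2⟩ := hy.unique 𝔊 hΩ h2 hTm
    exact ⟨e1.trans k2, e2.trans k4⟩
  · intro y0 y1 b _ v _ Y₁ Y₂ Y₁' Y₂' ⟨h1, h2⟩
    have h := (𝔊.rest_iff_pairing_eq_zero hΩ hT
      (WaveGroup.continuousOn_neg_mulL2 hc.1 h2.cont) h1).trans
      (𝔊.insensitizesBoundary_iff hΩ hT hc.1 h2).symm
    refine ⟨h, fun ⟨k1, k2, k3, k4⟩ => ⟨⟨⟨_, _, h2⟩, fun y y' hy => ?_⟩, h.1 ⟨k1, k3⟩⟩⟩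
    obtain ⟨e1, e2⟩ := hy.unique 𝔊 hΩ h2 hTm
    exact ⟨e1.trans k2, e2.trans k4⟩
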